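/- A *profile* over an interval $I\subset\mathbb R$ is a triple of $C^1$ functions $(\rho,h,\theta)$ on $I$ with $\cos\theta\,h'+\sin\theta\,\rho'=0$. It represents the (possibly singular) surface of revolution $\{(\rho\sin\phi,\rho\cos\phi,h)\}$ about the $x^3$-axis with unit normal $(\sin\theta\sin\phi,\sin\theta\cos\phi,\cos\theta)$. A *connected rotationally symmetric surface* (of class $C^2$, possibly with boundary) is given by an arc-length parametrized profile curve over an interval $I$ with non-empty interior: $\rho'=\cos\theta$, $h'=-\sin\theta$, $\theta\in C^1(I)$, where $\rho\neq0$ in the interior of $I$, and $\sin\theta=0$ at any end point of $I$ (belonging to $I$) where $\rho=0$ (a pole). Its principal curvatures are $k_2=\theta'$ (along the profile curve) and $k_1=\sin\theta/\rho$ (along the circles of latitude), with $k_1=k_2$ at poles. For profiles $(\rho,h,\theta)$ and $(\tilde\rho,\tilde h,\tilde\theta)$ over the same interval, the second is obtained from the first by * a *homothety* if $(\tilde\rho,\tilde h,\tilde\theta)=(c\rho,ch,\theta)$ for a constant $c>0$; * a *parallel translation* if $(\tilde\rho,\tilde h,\tilde\theta)=(\rho+v\sin\theta,\,h+v\cos\theta,\,\theta)$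 for a constant $v\in\mathbb R$; * a *reciprocal transformation* if $\sin\tilde\theta=\mathcal A\rho$ and $\tilde\rho=-\mathcal A\sin\theta$ for a constant $\mathcal A\neq0$. A surface $\mathcal S$ with parameter interval $I$ is *the image under a composition of such transformations* of a surface $\mathcal S_0$ with parameter interval $J$ if there are a continuous surjection $\sigma:I\to J$ and a finite chain of such transformations, between profiles over $I$, that leads from $(\rho_0\circ\sigma,h_0\circ\sigma,\theta_0\circ\sigma)$ to the profile of $\mathcal S$. (The map $\sigma$ may fail to be injective, as a reciprocal transformation only prescribes the sine of the new angle.) **Theorem.** Let $\mathcal S$ be a connected rotationally symmetric surface that satisfies $$\alpha k_1k_2+\beta k_1+\gamma k_2+\delta=0,\qquad \alpha,\beta,\gamma,\delta\in\mathbb R,$$ and put $\Lambda_1=\beta-\gamma$, $\Lambda_2=(\beta+\gamma)^2-4\alpha\delta$. If $\Lambda_2>0$, then there are $\lambda\in\mathbb R$ and a connected rotationally symmetric surface $\mathcal S_0$ satisfying $k_2=\lambda k_1$ such that $\mathcal S$ is the image of $\mathcal S_0$ under a composition of homotheties, parallel translations and reciprocal transformations. If moreover $\mathcal S$ is not a piece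 of a circular cylinder, then $\lambda$ can be chosen with $\lambda<0$ when $\mathcal S$ is elliptic ($\Lambda_2>\Lambda_1^2$), and with $\lambda>0$ when $\mathcal S$ is hyperbolic ($\Lambda_2<\Lambda_1^2$). -/

import Mathlib

open Set

/-- The profile data of a surface of revolution about the `x³`-axis, as functions of a parameter:
`(ρ, h)` are the cylindrical coordinates of the profile curve (`ρ` is a signed distance from the
axis) and `θ` is the Gauss angle: the unit normal has radial component `sin θ` and axial component
`cos θ`. Only the values on the relevant parameter interval matter. -/
structure Profile where
  ρ : ℝ → ℝ
  h : ℝ → ℝ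
  θ : ℝ → ℝ

/-- Derivatives of curves in Euclidean space are computed coordinatewise. -/
theorem hasDerivWithinAt_euclidean₃ {f : ℝ → EuclideanSpace ℝ (Fin 3)}
    {f' : EuclideanSpace ℝ (Fin 3)} {s : Set ℝ} {t : ℝ}
    (H : ∀ i, HasDerivWithinAt (fun x => f x i) (f' i) s t) : HasDerivWithinAt f f' s t := by
  rw [hasDerivWithinAt_iff_hasFDerivWithinAt, hasFDerivWithinAt_euclidean]
  intro i
  have key : PiLp.proj 2 (fun _ : Fin 3 => ℝ) i ∘L ContinuousLinearMap.toSpanSingleton ℝ f'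
      = ContinuousLinearMap.toSpanSingleton ℝ (f' i) := by
    ext
    simp
  exact key ▸ (H i).hasFDerivWithinAt

namespace Profile

/-- The point of the surface with parameter `t` and rotation angle `φ`. -/
noncomputable def position (P : Profile) (t φ : ℝ) : EuclideanSpace ℝ (Fin 3) :=
  !₂[P.ρ t * Real.sin φ, P.ρ t * Real.cos φ, P.h t]

/-- The unit normal at the point with parameter `t` and rotation angle `φ`. -/
noncomputable def normal (P : Profile) (t φ : ℝ) : EuclideanSpace ℝ (Fin 3) :=
  !₂[Real.sin (P.θ t) * Real.sin φ, Real.sin (P.θ t) * Real.cos φ, Real.cos (P.θ t)]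

/-- Precomposition with a change of parameter. -/
def comp (P : Profile) (σ : ℝ → ℝ) : Profile := ⟨P.ρ ∘ σ, P.h ∘ σ, P.θ ∘ σ⟩

/-- A (possibly singular) profile over the parameter interval `I`: the data are `C¹` and the
direction `(sin θ, cos θ)` is normal to the curve `(ρ, h)`, that is `dh = - tan θ dρ`. The curve
`(ρ, h)` need not be immersed: the surface may have cusps and folds, or degenerate to a curve or
to a point (such as a sphere of radius zero). -/
structure IsFrontOn (I : Set ℝ) (P : Profile) : Prop where
  contDiffOn_ρ : ContDiffOn ℝ 1 P.ρ I
  contDiffOn_h : ContDiffOn ℝ 1 P.h I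
  contDiffOn_θ : ContDiffOn ℝ 1 P.θ I
  contact : ∀ t ∈ I, Real.cos (P.θ t) * derivWithin P.h I t
    + Real.sin (P.θ t) * derivWithin P.ρ I t = 0

/-- `Q` is obtained from `P` by a homothety of positive ratio centred at the origin. -/
def Homothety (I : Set ℝ) (P Q : Profile) : Prop :=
  ∃ c : ℝ, 0 < c ∧ ∀ t ∈ I, Q.ρ t = c * P.ρ t ∧ Q.h t = c * P.h t ∧ Q.θ t = P.θ t

/-- `Q` is obtained from `P` by moving every point by the distance `v` in the direction of the
unit normal. -/
def ParallelTranslation (I : Set ℝ) (P Q : Profile) : Prop :=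
  ∃ v : ℝ, ∀ t ∈ I, Q.ρ t = P.ρ t + v * Real.sin (P.θ t) ∧
    Q.h t = P.h t + v * Real.cos (P.θ t) ∧ Q.θ t = P.θ t

/-- `Q` is obtained from `P` by a reciprocal transformation: `sin θ̃ = A ρ` and `ρ̃ = - A sin θ`.
The height of `Q` is determined, up to integration, by the contact condition in `IsFrontOn`. -/
def ReciprocalTransformation (I : Set ℝ) (P Q : Profile) : Prop :=
  ∃ A : ℝ, A ≠ 0 ∧ ∀ t ∈ I, Real.sin (Q.θ t) = A * P.ρ t ∧ Q.ρ t = -A * Real.sin (P.θ t)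

/-- One homothety, parallel translation or reciprocal transformation between profiles. -/
def Step (I : Set ℝ) (P Q : Profile) : Prop :=
  IsFrontOn I P ∧ IsFrontOn I Q ∧
    (Homothety I P Q ∨ ParallelTranslation I P Q ∨ ReciprocalTransformation I P Q)

end Profile

/-- A connected `C²` surface of revolution about the `x³`-axis (immersed, possibly with boundary,
possibly meeting the axis in poles), given by the arc-length parametrization of its profile curve
over an interval `I`. The tangent is `(cos θ, - sin θ)`; as the tangent angle is `C¹`, the profile
curve is `C²`. The profile can meet the axis only at end points of `I`, and then orthogonally. -/
structure RevolutionSurface extends Profile where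
  I : Set ℝ
  ordConnected_I : I.OrdConnected
  nonempty_interior_I : (interior I).Nonempty
  hasDerivWithinAt_ρ : ∀ t ∈ I, HasDerivWithinAt ρ (Real.cos (θ t)) I t
  hasDerivWithinAt_h : ∀ t ∈ I, HasDerivWithinAt h (-Real.sin (θ t)) I t
  contDiffOn_θ : ContDiffOn ℝ 1 θ I
  ρ_ne_zero : ∀ t ∈ interior I, ρ t ≠ 0
  sin_θ_eq_zero : ∀ t ∈ I, ρ t = 0 → Real.sin (θ t) = 0

namespace RevolutionSurface

/-- The principal curvature in the direction of the profile curve. -/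
noncomputable def k₂ (S : RevolutionSurface) (t : ℝ) : ℝ := derivWithin S.θ S.I t

open Classical in
/-- The principal curvature in the direction of the circles of latitude; poles are umbilic. -/
noncomputable def k₁ (S : RevolutionSurface) (t : ℝ) : ℝ :=
  if S.ρ t = 0 then S.k₂ t else Real.sin (S.θ t) / S.ρ t

/-- Rodrigues' formula along the profile curve: `∂N/∂t = k₂ ∂X/∂t`. -/
theorem rodrigues_profile (S : RevolutionSurface) (φ : ℝ) {t : ℝ} (ht : t ∈ S.I) :
    ∃ X' : EuclideanSpace ℝ (Fin 3), ‖X'‖ = 1 ∧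
      HasDerivWithinAt (fun s => S.position s φ) X' S.I t ∧
      HasDerivWithinAt (fun s => S.normal s φ) (S.k₂ t • X') S.I t := by
  have hθ : HasDerivWithinAt S.θ (S.k₂ t) S.I t :=
    ((S.contDiffOn_θ.differentiableOn (by norm_num)) t ht).hasDerivWithinAt
  refine ⟨!₂[Real.cos (S.θ t) * Real.sin φ, Real.cos (S.θ t) * Real.cos φ, -Real.sin (S.θ t)],
    ?_, ?_, ?_⟩
  · rw [EuclideanSpace.norm_eq, Real.sqrt_eq_one]
    simp [Fin.sum_univ_three]
    nlinarith [Real.sin_sq_add_cos_sq φ, Real.sin_sq_add_cos_sq (S.θ t)]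
  · refine hasDerivWithinAt_euclidean₃ fun i => ?_
    fin_cases i
    · exact (S.hasDerivWithinAt_ρ t ht).mul_const _
    · exact (S.hasDerivWithinAt_ρ t ht).mul_const _
    · exact S.hasDerivWithinAt_h t ht
  · refine hasDerivWithinAt_euclidean₃ fun i => ?_
    fin_cases i
    · have := hθ.sin.mul_const (Real.sin φ)
      simpa [Profile.normal, mul_comm, mul_left_comm, mul_assoc] using this
    · have := hθ.sin.mul_const (Real.cos φ)
      simpa [Profile.normal, mul_comm, mul_left_comm, mul_assoc] using this
    · have := hθ.cos
      simpa [Profile.normal, mul_comm, mul_left_comm, mul_assoc] using this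

/-- Rodrigues' formula along the circles of latitude: `∂N/∂φ = k₁ ∂X/∂φ`. -/
theorem rodrigues_latitude (S : RevolutionSurface) (φ : ℝ) {t : ℝ} (ht : t ∈ S.I) :
    ∃ X' : EuclideanSpace ℝ (Fin 3), ‖X'‖ = |S.ρ t| ∧
      HasDerivAt (fun ψ => S.position t ψ) X' φ ∧
      HasDerivAt (fun ψ => S.normal t ψ) (S.k₁ t • X') φ := by
  have hk : Real.sin (S.θ t) = S.k₁ t * S.ρ t := by
    unfold k₁
    split_ifs with h0
    · rw [S.sin_θ_eq_zero t ht h0, h0, mul_zero]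
    · field_simp
  refine ⟨!₂[S.ρ t * Real.cos φ, S.ρ t * (-Real.sin φ), 0], ?_, ?_, ?_⟩
  · rw [EuclideanSpace.norm_eq, ← Real.sqrt_sq_eq_abs]
    congr 1
    simp [Fin.sum_univ_three]
    nlinarith [Real.sin_sq_add_cos_sq φ]
  · rw [← hasDerivWithinAt_univ]
    refine hasDerivWithinAt_euclidean₃ fun i => ?_
    rw [hasDerivWithinAt_univ]
    fin_cases i
    · exact (Real.hasDerivAt_sin φ).const_mul _
    · exact (Real.hasDerivAt_cos φ).const_mul _
    · exact hasDerivAt_const φ _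
  · rw [← hasDerivWithinAt_univ]
    refine hasDerivWithinAt_euclidean₃ fun i => ?_
    rw [hasDerivWithinAt_univ]
    fin_cases i
    · have := (Real.hasDerivAt_sin φ).const_mul (Real.sin (S.θ t))
      rw [hk] at this
      simpa [Profile.normal, hk, mul_assoc] using this
    · have := (Real.hasDerivAt_cos φ).const_mul (Real.sin (S.θ t))
      rw [hk] at this
      simpa [Profile.normal, hk, mul_assoc] using this
    · simpa [Profile.normal] using hasDerivAt_const φ (Real.cos (S.θ t))

/-- The semi-quadratic Weingarten relation `α k₁ k₂ + β k₁ + γ k₂ + δ = 0`. -/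
def IsSemiQuadratic (S : RevolutionSurface) (α β γ δ : ℝ) : Prop :=
  ∀ t ∈ S.I, α * S.k₁ t * S.k₂ t + β * S.k₁ t + γ * S.k₂ t + δ = 0

/-- The Weingarten relation `k₂ = lam * k₁`. -/
def IsPureLinear (S : RevolutionSurface) (lam : ℝ) : Prop :=
  ∀ t ∈ S.I, S.k₂ t = lam * S.k₁ t

/-- The surface is a piece of a circular cylinder: its normal is everywhere horizontal. -/
def IsCylinder (S : RevolutionSurface) : Prop :=
  ∀ t ∈ S.I, Real.cos (S.θ t) = 0

/-- `S` is the image of `S₀` under a composition of homotheties, parallel translations and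
reciprocal transformations. Corresponding points have the same parameter `t ∈ S.I`: the profile
of `S₀` is traversed as `S₀ ∘ σ` with `σ` continuous and onto, and is transformed step by step into
the profile of `S`. The map `σ` need not be injective, because a reciprocal transformation is
multivalued: it prescribes only the sine of the new Gauss angle. -/
def IsImageOf (S S₀ : RevolutionSurface) : Prop :=
  ∃ σ : ℝ → ℝ, ContinuousOn σ S.I ∧ σ '' S.I = S₀.I ∧
    Relation.ReflTransGen (Profile.Step S.I) (S₀.toProfile.comp σ) S.toProfile

end RevolutionSurface

/-- The quantity `Λ₁ = β - γ` of a semi-quadratic relation. -/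
def Lambda₁ (β γ : ℝ) : ℝ := β - γ

/-- The quantity `Λ₂ = (β + γ)² - 4 α δ` of a semi-quadratic relation. -/
def Lambda₂ (α β γ δ : ℝ) : ℝ := (β + γ) ^ 2 - 4 * α * δ

/-! Put `s = sin θ`. Since `ρ' = cos θ` and `s' = k₂ cos θ`, the Weingarten relation multiplied by
`ρ` says that `(ρ, s)` runs along trajectories of the linear field `(αs + γρ, -βs - δρ)`. Its
characteristic polynomial has discriminant `Λ₂`, and its determinant is `αδ - βγ = (Λ₁² - Λ₂)/4`. So
`Λ₂ > 0` means two distinct real eigenvalues `μ₁`, `μ₂`, of opposite signs in the elliptic case and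
of equal signs in the hyperbolic case. Eigencoordinates `x`, `y` evolve as exponentials of the flow
time (`IsSemiQuadratic.exists_exp`), hence `y = K x ^ lam` with `lam = μ₂ / μ₁`
(`IsSemiQuadratic.exists_rpow`). This is the relation between axis distance and sine on a surface
with `k₂ = lam * k₁`.

The three transformations act linearly on `(ρ, s)`, by `diag(c, 1)`, by shears and by `(ρ, s) ↦ (-A
s, A ρ)`; together they produce all matrices of positive determinant (`Profile.Reach.linear`). Hence
the surface with data `(x, εy)` is carried to `S` (`exists_isPureLinear_of_radial`).

The difficulty is that every second coordinate on the way has to be the sine of a `C¹` angle.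
Intermediate sines are kept in `[-1/2, 1/2]`, which requires `ρ` to be bounded; this is deduced from
the power law and `|s| ≤ 1`. It can fail in the elliptic case with `δ = 0`, but there `s` itself is
an eigencoordinate and one parallel translation suffices (`exists_isPureLinear_of_parallel`). If `αδ
= βγ`, then `k₂` is constant, `s` is affine in `ρ`, and `S` comes from a plane or a cone. -/

/-! ### Calculus on intervals -/

theorem Set.OrdConnected.eq_of_hasDerivWithinAt_zero {I : Set ℝ} (hI : I.OrdConnected)
    {f : ℝ → ℝ} (hf : ∀ t ∈ I, HasDerivWithinAt f 0 I t) {s t : ℝ} (hs : s ∈ I) (ht : t ∈ I) :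
    f s = f t := by
  have := hI.convex.norm_image_sub_le_of_norm_hasDerivWithin_le (C := 0) hf (by simp) ht hs
  simpa [sub_eq_zero] using this

/-- A continuous function on an interval has an antiderivative. -/
theorem ContinuousOn.exists_hasDerivWithinAt {I : Set ℝ} (hI : I.OrdConnected) {g : ℝ → ℝ}
    (hg : ContinuousOn g I) : ∃ G : ℝ → ℝ, ∀ t ∈ I, HasDerivWithinAt G (g t) I t := by
  rcases I.eq_empty_or_nonempty with rfl | ⟨t₀, ht₀⟩
  · exact ⟨0, by simp⟩
  have hint : ∀ s ∈ I, ∀ t ∈ I, IntervalIntegrable g MeasureTheory.volume s t := fun s hs t ht =>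
    (hg.mono (hI.uIcc_subset hs ht)).intervalIntegrable
  refine ⟨fun t => ∫ s in t₀..t, g s, fun t ht => ?_⟩
  rw [hasDerivWithinAt_iff_isLittleO, Asymptotics.isLittleO_iff]
  intro ε hε
  obtain ⟨r, hr, hr'⟩ := Metric.continuousWithinAt_iff.1 (hg t ht) ε hε
  filter_upwards [inter_mem_nhdsWithin I (Metric.ball_mem_nhds t hr)] with t' ht'
  have h1 : (∫ s in t₀..t', g s) - (∫ s in t₀..t, g s) - (t' - t) • g t
      = ∫ s in t..t', (g s - g t) := by
    rw [intervalIntegral.integral_interval_sub_left (hint _ ht₀ _ ht'.1) (hint _ ht₀ _ ht),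
      intervalIntegral.integral_sub (hint _ ht _ ht'.1) intervalIntegrable_const,
      intervalIntegral.integral_const]
  rw [h1, Real.norm_eq_abs (t' - t)]
  refine intervalIntegral.norm_integral_le_of_norm_le_const fun s hs => ?_
  have hs' := uIoc_subset_uIcc hs
  have : dist s t < r := by
    refine lt_of_le_of_lt ?_ (Metric.mem_ball.1 ht'.2)
    rw [Real.dist_eq, Real.dist_eq]
    exact abs_sub_left_of_mem_uIcc hs'
  exact (hr' (hI.uIcc_subset ht ht'.1 hs') this).le

theorem contDiffOn_one_of_hasDerivWithinAt {I : Set ℝ} (hI : UniqueDiffOn ℝ I) {f f' : ℝ → ℝ}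
    (hf : ∀ t ∈ I, HasDerivWithinAt f (f' t) I t) (hf' : ContinuousOn f' I) :
    ContDiffOn ℝ 1 f I := by
  rw [contDiffOn_one_iff_derivWithin hI]
  exact ⟨fun t ht => (hf t ht).differentiableWithinAt,
    hf'.congr fun t ht => (hf t ht).derivWithin (hI t ht)⟩

theorem Set.OrdConnected.uniqueDiffOn {I : Set ℝ} (hI : I.OrdConnected)
    (hI' : (interior I).Nonempty) : UniqueDiffOn ℝ I :=
  uniqueDiffOn_convex hI.convex hI'

/-- A property that is closed relative to an interval extends from the interior. -/
theorem Set.OrdConnected.eqOn_of_interior {I : Set ℝ} (hI : I.OrdConnected)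
    (hI' : (interior I).Nonempty) {f g : ℝ → ℝ} (hf : ContinuousOn f I) (hg : ContinuousOn g I)
    (h : EqOn f g (interior I)) : EqOn f g I := by
  refine h.of_subset_closure hf hg interior_subset ?_
  rw [Convex.closure_interior_eq_closure_of_nonempty_interior (𝕜 := ℝ) hI.convex hI']
  exact subset_closure

theorem Set.OrdConnected.nonneg_of_interior {I : Set ℝ} (hI : I.OrdConnected)
    (hI' : (interior I).Nonempty) {f : ℝ → ℝ} (hf : ContinuousOn f I)
    (h : ∀ t ∈ interior I, 0 ≤ f t) : ∀ t ∈ I, 0 ≤ f t := by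
  have := hI.eqOn_of_interior hI' hf hf.abs fun t ht => (abs_of_nonneg (h t ht)).symm
  exact fun t ht => (this ht).symm ▸ abs_nonneg _

theorem Profile.IsFrontOn.of_hasDerivWithinAt {I : Set ℝ} (hI : UniqueDiffOn ℝ I) {P : Profile}
    {ρ' h' : ℝ → ℝ} (hρ : ∀ t ∈ I, HasDerivWithinAt P.ρ (ρ' t) I t)
    (hh : ∀ t ∈ I, HasDerivWithinAt P.h (h' t) I t) (hρ' : ContinuousOn ρ' I)
    (hh' : ContinuousOn h' I) (hθ : ContDiffOn ℝ 1 P.θ I)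
    (hc : ∀ t ∈ I, Real.cos (P.θ t) * h' t + Real.sin (P.θ t) * ρ' t = 0) :
    P.IsFrontOn I where
  contDiffOn_ρ := contDiffOn_one_of_hasDerivWithinAt hI hρ hρ'
  contDiffOn_h := contDiffOn_one_of_hasDerivWithinAt hI hh hh'
  contDiffOn_θ := hθ
  contact t ht := by
    rw [(hρ t ht).derivWithin (hI t ht), (hh t ht).derivWithin (hI t ht)]
    exact hc t ht

/-! ### Regularity of surfaces of revolution and their reparametrizations -/

namespace RevolutionSurface

variable (S : RevolutionSurface)

theorem uniqueDiffOn : UniqueDiffOn ℝ S.I := S.ordConnected_I.uniqueDiffOn S.nonempty_interior_I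

theorem continuousOn_θ : ContinuousOn S.θ S.I := S.contDiffOn_θ.continuousOn

theorem continuousOn_ρ : ContinuousOn S.ρ S.I := fun t ht =>
  (S.hasDerivWithinAt_ρ t ht).continuousWithinAt

theorem continuousOn_sin : ContinuousOn (fun t => Real.sin (S.θ t)) S.I :=
  Real.continuous_sin.comp_continuousOn S.continuousOn_θ

theorem continuousOn_cos : ContinuousOn (fun t => Real.cos (S.θ t)) S.I :=
  Real.continuous_cos.comp_continuousOn S.continuousOn_θ

theorem continuousOn_k₂ : ContinuousOn S.k₂ S.I :=
  S.contDiffOn_θ.continuousOn_derivWithin S.uniqueDiffOn (by norm_num)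

theorem hasDerivWithinAt_θ {t : ℝ} (ht : t ∈ S.I) : HasDerivWithinAt S.θ (S.k₂ t) S.I t :=
  ((S.contDiffOn_θ.differentiableOn (by norm_num)) t ht).hasDerivWithinAt

theorem hasDerivWithinAt_sin {t : ℝ} (ht : t ∈ S.I) :
    HasDerivWithinAt (fun t => Real.sin (S.θ t)) (Real.cos (S.θ t) * S.k₂ t) S.I t :=
  (S.hasDerivWithinAt_θ ht).sin

theorem hasDerivWithinAt_lin (a b : ℝ) {t : ℝ} (ht : t ∈ S.I) :
    HasDerivWithinAt (fun t => a * S.ρ t + b * Real.sin (S.θ t))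
      (Real.cos (S.θ t) * (a + b * S.k₂ t)) S.I t := by
  have := ((S.hasDerivWithinAt_ρ t ht).const_mul a).add ((S.hasDerivWithinAt_sin ht).const_mul b)
  exact this.congr_deriv (by ring)

theorem continuousOn_lin (a b : ℝ) :
    ContinuousOn (fun t => a * S.ρ t + b * Real.sin (S.θ t)) S.I :=
  fun _ ht => (S.hasDerivWithinAt_lin a b ht).continuousWithinAt

theorem sin_eq_k₁_mul {t : ℝ} (ht : t ∈ S.I) : Real.sin (S.θ t) = S.k₁ t * S.ρ t := by
  unfold k₁
  split_ifs with h0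
  · rw [S.sin_θ_eq_zero t ht h0, h0, mul_zero]
  · field_simp

theorem isFrontOn : S.IsFrontOn S.I :=
  .of_hasDerivWithinAt S.uniqueDiffOn S.hasDerivWithinAt_ρ S.hasDerivWithinAt_h S.continuousOn_cos
    S.continuousOn_sin.neg S.contDiffOn_θ fun t _ => by ring

theorem isImageOf_self : S.IsImageOf S :=
  ⟨id, continuousOn_id, image_id _, Relation.ReflTransGen.refl⟩

/-- A reparametrized profile of a surface is a (possibly singular) front. -/
theorem isFrontOn_comp {I : Set ℝ} (hI : UniqueDiffOn ℝ I) {σ σ' : ℝ → ℝ}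
    (hσ : ∀ t ∈ I, HasDerivWithinAt σ (σ' t) I t) (hσ' : ContinuousOn σ' I)
    (hm : MapsTo σ I S.I) : (S.toProfile.comp σ).IsFrontOn I := by
  have hc : ContinuousOn σ I := fun t ht => (hσ t ht).continuousWithinAt
  refine .of_hasDerivWithinAt hI
    (ρ' := fun t => Real.cos (S.θ (σ t)) * σ' t) (h' := fun t => -Real.sin (S.θ (σ t)) * σ' t)
    (fun t ht => (S.hasDerivWithinAt_ρ _ (hm ht)).comp t (hσ t ht) hm)
    (fun t ht => (S.hasDerivWithinAt_h _ (hm ht)).comp t (hσ t ht) hm)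
    ((S.continuousOn_cos.comp hc hm).mul hσ') ((S.continuousOn_sin.comp hc hm).neg.mul hσ')
    (S.contDiffOn_θ.comp (contDiffOn_one_of_hasDerivWithinAt hI hσ hσ') hm) fun t _ => ?_
  simp only [Profile.comp, Function.comp_apply]
  ring

theorem isPureLinear_of_k₂_eq_zero (h : ∀ t ∈ S.I, S.k₂ t = 0) : S.IsPureLinear 0 := fun t ht => by
  rw [h t ht, zero_mul]

theorem IsCylinder.k₂_eq_zero {S : RevolutionSurface} (h : S.IsCylinder) {t : ℝ} (ht : t ∈ S.I) :
    S.k₂ t = 0 := by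
  have h1 : HasDerivWithinAt (fun t => Real.cos (S.θ t)) (-Real.sin (S.θ t) * S.k₂ t) S.I t :=
    (S.hasDerivWithinAt_θ ht).cos
  have h2 : HasDerivWithinAt (fun t => Real.cos (S.θ t)) 0 S.I t :=
    (hasDerivWithinAt_const t S.I (0 : ℝ)).congr_of_mem h ht
  have h3 := (S.uniqueDiffOn t ht).eq_deriv _ h1 h2
  have h4 := Real.sin_sq_add_cos_sq (S.θ t)
  rw [h t ht] at h4
  rcases mul_eq_zero.1 h3 with h5 | h5
  · rw [neg_eq_zero.1 h5] at h4; norm_num at h4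
  · exact h5

end RevolutionSurface

/-! ### Model surfaces given as graphs over the axis distance -/

/-- The arc length of the graph over the axis-distance whose normal has radial component `F`. -/
theorem exists_arcLength_orderIso {F : ℝ → ℝ} (hF : Continuous F) (hF' : ∀ r, |F r| ≤ 1 / 2) :
    ∃ e : ℝ ≃o ℝ, ∀ r, HasDerivAt e (√(1 - F r ^ 2))⁻¹ r := by
  have hpos : ∀ r, 0 < √(1 - F r ^ 2) := fun r => by
    apply Real.sqrt_pos.2
    nlinarith [abs_le.1 (hF' r)]
  have hle : ∀ r, 1 ≤ (√(1 - F r ^ 2))⁻¹ := fun r =>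
    (one_le_inv₀ (hpos r)).2 (Real.sqrt_le_one.2 (by nlinarith [sq_nonneg (F r)]))
  have hcont : Continuous fun r => (√(1 - F r ^ 2))⁻¹ :=
    (Real.continuous_sqrt.comp (continuous_const.sub (hF.pow 2))).inv₀ fun r => (hpos r).ne'
  obtain ⟨T, hT⟩ := (continuousOn_univ.2 hcont).exists_hasDerivWithinAt ordConnected_univ
  replace hT : ∀ r, HasDerivAt T (√(1 - F r ^ 2))⁻¹ r := fun r => by simpa using hT r (mem_univ r)
  have hmono : StrictMono T := strictMono_of_deriv_pos fun r => by
    rw [(hT r).deriv]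
    exact inv_pos.2 (hpos r)
  -- The speed of `T` is at least 1, so `T` outgrows the identity at both ends; this gives
  -- surjectivity.
  have hmono' : Monotone fun r => T r - r := by
    refine monotone_of_deriv_nonneg (fun r => ((hT r).sub (hasDerivAt_id r)).differentiableAt)
      fun r => ?_
    rw [((hT r).fun_sub (hasDerivAt_id' r)).deriv]
    linarith [hle r]
  have hsurj : Function.Surjective T := by
    refine Continuous.surjective (continuous_iff_continuousAt.2 fun r => (hT r).continuousAt) ?_ ?_
    · refine Filter.tendsto_atTop_mono' _ ?_
        (Filter.tendsto_atTop_add_const_right _ (T 0) Filter.tendsto_id)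
      filter_upwards [Filter.eventually_ge_atTop 0] with r hr
      have := hmono' hr
      simp only [id] at this ⊢
      linarith
    · refine Filter.tendsto_atBot_mono' _ ?_
        (Filter.tendsto_atBot_add_const_right _ (T 0) Filter.tendsto_id)
      filter_upwards [Filter.eventually_le_atBot 0] with r hr
      have := hmono' hr
      simp only [id] at this ⊢
      linarith
  exact ⟨hmono.orderIsoOfSurjective T hsurj, hT⟩

/-- The surface whose Gauss angle is given as a function `arcsin ∘ F` of the distance `r` to the
axis, where `r F' = lam F`. -/
theorem RevolutionSurface.exists_of_radial {F f : ℝ → ℝ} {R : Set ℝ} {lam : ℝ} (hF : Continuous F)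
    (hF' : ∀ r, |F r| ≤ 1 / 2) (hR : R.OrdConnected) (hR' : R.Nontrivial) (hR₀ : ∀ r ∈ R, 0 ≤ r)
    (hf : ∀ r ∈ R, HasDerivWithinAt F (f r) R r) (hfc : ContinuousOn f R)
    (hlam : ∀ r ∈ R, r * f r = lam * F r) (h0 : 0 ∈ R → F 0 = 0 ∧ f 0 = 0) :
    ∃ (S₀ : RevolutionSurface) (T : ℝ → ℝ), (∀ r, HasDerivAt T (√(1 - F r ^ 2))⁻¹ r) ∧
      S₀.I = T '' R ∧ (∀ r, S₀.ρ (T r) = r ∧ S₀.θ (T r) = Real.arcsin (F r)) ∧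
      S₀.IsPureLinear lam := by
  obtain ⟨e, he⟩ := exists_arcLength_orderIso hF hF'
  have hτ : ∀ t, HasDerivAt e.symm (√(1 - F (e.symm t) ^ 2)) t := fun t => by
    have := HasDerivAt.of_local_left_inverse (f := e) (g := e.symm) (a := t)
      e.symm.continuous.continuousAt (he _) ?_ (.of_forall fun y => e.apply_symm_apply y)
    · simpa using this
    · refine inv_ne_zero (Real.sqrt_pos.2 ?_).ne'
      nlinarith [abs_le.1 (hF' (e.symm t))]
  have hFτ : Continuous (F ∘ e.symm) := hF.comp e.symm.continuous
  obtain ⟨H, hH⟩ := (continuousOn_univ.2 hFτ.neg).exists_hasDerivWithinAt ordConnected_univ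
  replace hH : ∀ t, HasDerivAt H (-(F (e.symm t))) t := fun t => by simpa using hH t (mem_univ t)
  have hmaps : MapsTo e.symm (e '' R) R := by
    rintro _ ⟨r, hr, rfl⟩
    simpa using hr
  have hsin : ∀ t, Real.sin (Real.arcsin (F (e.symm t))) = F (e.symm t) := fun t => by
    have := abs_le.1 (hF' (e.symm t))
    exact Real.sin_arcsin (by linarith) (by linarith)
  have hθ : ∀ t ∈ e '' R, HasDerivWithinAt (fun t => Real.arcsin (F (e.symm t))) (f (e.symm t))
      (e '' R) t := fun t ht => by
    have h1 := abs_le.1 (hF' (e.symm t))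
    have h2 : 0 < √(1 - F (e.symm t) ^ 2) := Real.sqrt_pos.2 (by nlinarith)
    have h3 := (hf _ (hmaps ht)).comp t (hτ t).hasDerivWithinAt hmaps
    have h4 := (Real.hasDerivAt_arcsin (x := F (e.symm t)) (by linarith) (by linarith)
      ).comp_hasDerivWithinAt t h3
    refine h4.congr_deriv ?_
    field_simp
  have hord : (e '' R).OrdConnected := (hR.isPreconnected.image e e.continuous.continuousOn
    ).ordConnected
  have hint : (interior (e '' R)).Nonempty := by
    obtain ⟨r₀, h₀, r₁, h₁, hlt⟩ := hR'.exists_lt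
    refine Nonempty.mono (interior_mono (hord.out (mem_image_of_mem e h₀) (mem_image_of_mem e h₁)))
      ?_
    rw [interior_Icc]
    exact nonempty_Ioo.2 (e.strictMono hlt)
  have hfτ : ContinuousOn (fun t => f (e.symm t)) (e '' R) :=
    hfc.comp e.symm.continuous.continuousOn hmaps
  let S₀ : RevolutionSurface :=
    { ρ := e.symm
      h := H
      θ := fun t => Real.arcsin (F (e.symm t))
      I := e '' R
      ordConnected_I := hord
      nonempty_interior_I := hint
      hasDerivWithinAt_ρ := fun t _ => by
        rw [Real.cos_arcsin]
        exact (hτ t).hasDerivWithinAt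
      hasDerivWithinAt_h := fun t _ => by
        rw [hsin]
        exact (hH t).hasDerivWithinAt
      contDiffOn_θ := contDiffOn_one_of_hasDerivWithinAt (hord.uniqueDiffOn hint) hθ hfτ
      -- To the left of an interior point there are smaller values of `r`, still nonnegative.
      ρ_ne_zero := fun t ht h => by
        obtain ⟨l, hl, hl'⟩ := exists_Ioc_subset_of_mem_nhds (mem_interior_iff_mem_nhds.1 ht)
          (exists_lt t)
        obtain ⟨t', ht'⟩ := exists_between hl
        have h1 := hR₀ _ (hmaps (hl' ⟨ht'.1, ht'.2.le⟩))
        have h2 := e.symm.strictMono ht'.2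
        linarith
      sin_θ_eq_zero := fun t ht h => by
        rw [hsin, h]
        exact (h0 (h ▸ hmaps ht)).1 }
  refine ⟨S₀, e, he, rfl, fun r => ⟨e.symm_apply_apply r, ?_⟩, fun t ht => ?_⟩
  · change Real.arcsin (F (e.symm (e r))) = _
    rw [e.symm_apply_apply]
  · have hk : S₀.k₂ t = f (e.symm t) := (hθ t ht).derivWithin (S₀.uniqueDiffOn t ht)
    unfold k₁
    rw [hk]
    change _ = lam * ite (e.symm t = 0) _ (Real.sin (Real.arcsin (F (e.symm t))) / e.symm t)
    rw [hsin]
    split_ifs with h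
    · rw [h, (h0 (h ▸ hmaps ht)).2, mul_zero]
    · have := hlam _ (hmaps ht)
      field_simp
      linarith

/-! ### Chains of transformations as linear maps of `(ρ, sin θ)` -/

namespace Profile

variable {I : Set ℝ} {P Q P₀ : Profile} {X Y : ℝ → ℝ}

namespace IsFrontOn

theorem hasDerivWithinAt_ρ (hP : P.IsFrontOn I) {t : ℝ} (ht : t ∈ I) :
    HasDerivWithinAt P.ρ (derivWithin P.ρ I t) I t :=
  (hP.contDiffOn_ρ.differentiableOn (by norm_num) t ht).hasDerivWithinAt

theorem hasDerivWithinAt_h (hP : P.IsFrontOn I) {t : ℝ} (ht : t ∈ I) :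
    HasDerivWithinAt P.h (derivWithin P.h I t) I t :=
  (hP.contDiffOn_h.differentiableOn (by norm_num) t ht).hasDerivWithinAt

theorem hasDerivWithinAt_θ (hP : P.IsFrontOn I) {t : ℝ} (ht : t ∈ I) :
    HasDerivWithinAt P.θ (derivWithin P.θ I t) I t :=
  (hP.contDiffOn_θ.differentiableOn (by norm_num) t ht).hasDerivWithinAt

theorem homothety (hI : UniqueDiffOn ℝ I) (hP : P.IsFrontOn I) (c : ℝ) :
    IsFrontOn I ⟨fun t => c * P.ρ t, fun t => c * P.h t, P.θ⟩ where
  contDiffOn_ρ := contDiffOn_const.mul hP.contDiffOn_ρ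
  contDiffOn_h := contDiffOn_const.mul hP.contDiffOn_h
  contDiffOn_θ := hP.contDiffOn_θ
  contact t ht := by
    rw [((hP.hasDerivWithinAt_ρ ht).const_mul c).derivWithin (hI t ht),
      ((hP.hasDerivWithinAt_h ht).const_mul c).derivWithin (hI t ht)]
    linear_combination c * hP.contact t ht

theorem parallel (hI : UniqueDiffOn ℝ I) (hP : P.IsFrontOn I) (v : ℝ) :
    IsFrontOn I ⟨fun t => P.ρ t + v * Real.sin (P.θ t), fun t => P.h t + v * Real.cos (P.θ t),
      P.θ⟩ where
  contDiffOn_ρ := hP.contDiffOn_ρ.add (contDiffOn_const.mul hP.contDiffOn_θ.sin)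
  contDiffOn_h := hP.contDiffOn_h.add (contDiffOn_const.mul hP.contDiffOn_θ.cos)
  contDiffOn_θ := hP.contDiffOn_θ
  contact t ht := by
    rw [((hP.hasDerivWithinAt_ρ ht).fun_add ((hP.hasDerivWithinAt_θ ht).sin.const_mul v)
        ).derivWithin (hI t ht),
      ((hP.hasDerivWithinAt_h ht).fun_add ((hP.hasDerivWithinAt_θ ht).cos.const_mul v)
        ).derivWithin (hI t ht)]
    linear_combination hP.contact t ht

/-- A front whose Gauss angle is the arcsine of a small function is determined by its distance to
the axis and its Gauss angle. -/
theorem exists_of_arcsin (hI : I.OrdConnected) (hI' : UniqueDiffOn ℝ I) (hX : ContDiffOn ℝ 1 X I)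
    (hY : ContDiffOn ℝ 1 Y I) (hY' : ∀ t ∈ I, |Y t| ≤ 1 / 2) :
    ∃ P : Profile, P.IsFrontOn I ∧ P.ρ = X ∧ P.θ = fun t => Real.arcsin (Y t) := by
  have hpos : ∀ t ∈ I, √(1 - Y t ^ 2) ≠ 0 := fun t ht =>
    (Real.sqrt_pos.2 (by nlinarith [abs_le.1 (hY' t ht)])).ne'
  have hX' : ContinuousOn (derivWithin X I) I := hX.continuousOn_derivWithin hI' (by norm_num)
  have hg : ContinuousOn (fun t => -(Y t / √(1 - Y t ^ 2) * derivWithin X I t)) I :=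
    ((hY.continuousOn.div (Real.continuous_sqrt.comp_continuousOn
      (continuousOn_const.sub (hY.continuousOn.pow 2))) hpos).mul hX').neg
  obtain ⟨h, hh⟩ := hg.exists_hasDerivWithinAt hI
  refine ⟨⟨X, h, fun t => Real.arcsin (Y t)⟩, .of_hasDerivWithinAt hI'
    (fun t ht => (hX.differentiableOn (by norm_num) t ht).hasDerivWithinAt) hh hX' hg ?_ ?_, rfl,
    rfl⟩
  · intro t ht
    have := abs_le.1 (hY' t ht)
    exact (Real.contDiffAt_arcsin (by linarith) (by linarith)).comp_contDiffWithinAt t (hY t ht)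
  · intro t ht
    have := abs_le.1 (hY' t ht)
    have h2 := hpos t ht
    simp only
    rw [Real.cos_arcsin, Real.sin_arcsin (by linarith) (by linarith)]
    field_simp
    ring

end IsFrontOn

/-- There is a chain of transformations from `P₀` to a front with distance `X` to the axis and with
Gauss angle `arcsin Y`. -/
def Reach (I : Set ℝ) (P₀ : Profile) (X Y : ℝ → ℝ) : Prop :=
  (∀ t ∈ I, |Y t| ≤ 1 / 2) ∧ ∃ P : Profile, Relation.ReflTransGen (Step I) P₀ P ∧
    P.IsFrontOn I ∧ ∀ t ∈ I, P.ρ t = X t ∧ P.θ t = Real.arcsin (Y t)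

namespace Reach

theorem congr (h : Reach I P₀ X Y) {X' Y' : ℝ → ℝ} (hX : EqOn X X' I) (hY : EqOn Y Y' I) :
    Reach I P₀ X' Y' := by
  obtain ⟨hb, P, hP, hP', hXY⟩ := h
  exact ⟨fun t ht => hY ht ▸ hb t ht, P, hP, hP', fun t ht => hX ht ▸ hY ht ▸ hXY t ht⟩

theorem homothety (hI : UniqueDiffOn ℝ I) (h : Reach I P₀ X Y) {c : ℝ} (hc : 0 < c) :
    Reach I P₀ (fun t => c * X t) Y := by
  obtain ⟨hb, P, hP, hP', hXY⟩ := h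
  refine ⟨hb, _, hP.tail ⟨hP', hP'.homothety hI c, .inl ⟨c, hc, fun t _ => ⟨rfl, rfl, rfl⟩⟩⟩,
    hP'.homothety hI c, fun t ht => ⟨?_, (hXY t ht).2⟩⟩
  simp only [(hXY t ht).1]

theorem sin_θ (hY : ∀ t ∈ I, |Y t| ≤ 1 / 2) (hP : ∀ t ∈ I, P.ρ t = X t ∧ P.θ t = Real.arcsin (Y t))
    {t : ℝ} (ht : t ∈ I) : Real.sin (P.θ t) = Y t := by
  have := abs_le.1 (hY t ht)
  rw [(hP t ht).2, Real.sin_arcsin (by linarith) (by linarith)]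

theorem parallel (hI : UniqueDiffOn ℝ I) (h : Reach I P₀ X Y) (v : ℝ) :
    Reach I P₀ (fun t => X t + v * Y t) Y := by
  obtain ⟨hb, P, hP, hP', hXY⟩ := h
  refine ⟨hb, _, hP.tail ⟨hP', hP'.parallel hI v, .inr (.inl ⟨v, fun t _ => ⟨rfl, rfl, rfl⟩⟩)⟩,
    hP'.parallel hI v, fun t ht => ⟨?_, (hXY t ht).2⟩⟩
  simp only [(hXY t ht).1, sin_θ hb hXY ht]

/-- A reciprocal transformation ends at any front with the required distance to the axis and the
required sine of the Gauss angle. -/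
theorem reciprocal (h : Reach I P₀ X Y) {A : ℝ} (hA : A ≠ 0) (hQ : Q.IsFrontOn I)
    (hθ : ∀ t ∈ I, Real.sin (Q.θ t) = A * X t) (hρ : ∀ t ∈ I, Q.ρ t = -A * Y t) :
    Relation.ReflTransGen (Step I) P₀ Q := by
  obtain ⟨hb, P, hP, hP', hXY⟩ := h
  refine hP.tail ⟨hP', hQ, .inr (.inr ⟨A, hA, fun t ht => ?_⟩)⟩
  rw [hθ t ht, hρ t ht, (hXY t ht).1, sin_θ hb hXY ht]
  exact ⟨rfl, rfl⟩

/-- The new angle may be any with the right sine; the arcsine branch is taken, which is `C¹` because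
the bound `1 / 2` keeps the sine away from `±1`. -/
theorem rotate (hI : I.OrdConnected) (hI' : UniqueDiffOn ℝ I) (h : Reach I P₀ X Y) {A : ℝ}
    (hA : A ≠ 0) (hAX : ∀ t ∈ I, |A * X t| ≤ 1 / 2) :
    Reach I P₀ (fun t => -A * Y t) (fun t => A * X t) := by
  have h' := h
  obtain ⟨hb, P, hP, hP', hXY⟩ := h'
  have hX : ContDiffOn ℝ 1 X I := hP'.contDiffOn_ρ.congr fun t ht => (hXY t ht).1.symm
  have hY : ContDiffOn ℝ 1 Y I := hP'.contDiffOn_θ.sin.congr fun t ht => (sin_θ hb hXY ht).symm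
  obtain ⟨Q, hQ, hQρ, hQθ⟩ := IsFrontOn.exists_of_arcsin hI hI' (contDiffOn_const (c := -A) |>.mul hY)
    (contDiffOn_const (c := A) |>.mul hX) hAX
  refine ⟨hAX, Q, h.reciprocal hA hQ (fun t ht => ?_) (fun t _ => by rw [hQρ]), hQ,
    fun t _ => by rw [hQρ, hQθ]; exact ⟨rfl, rfl⟩⟩
  have := abs_le.1 (hAX t ht)
  rw [hQθ, Real.sin_arcsin (by linarith) (by linarith)]

/-- Bruhat decomposition: for `c ≠ 0` the matrix is a shear, then the reciprocal map with constant
`c`, then a homothety fixing the determinant, then a shear. The only new sine is the final one, so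
no other bound is needed. -/
theorem linear_of_ne_zero (hI : I.OrdConnected) (hI' : UniqueDiffOn ℝ I) (h : Reach I P₀ X Y)
    {a b c d : ℝ} (hdet : 0 < a * d - b * c) (hc : c ≠ 0)
    (hb : ∀ t ∈ I, |c * X t + d * Y t| ≤ 1 / 2) :
    Reach I P₀ (fun t => a * X t + b * Y t) (fun t => c * X t + d * Y t) := by
  have h1 := h.parallel hI' (d / c)
  have h2 : ∀ t, c * (X t + d / c * Y t) = c * X t + d * Y t := fun t => by field_simp
  have h3 := (h1.rotate hI hI' hc fun t ht => by rw [h2]; exact hb t ht).homothety hI'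
    (c := (a * d - b * c) / c ^ 2) (by positivity)
  refine (h3.parallel hI' (a / c)).congr (fun t _ => ?_) fun t _ => h2 t
  field_simp
  ring

/-- All orientation preserving linear transformations of the distance to the axis and the sine of
the Gauss angle are realized by chains, as long as the data are bounded. -/
theorem linear (hI : I.OrdConnected) (hI' : UniqueDiffOn ℝ I) (h : Reach I P₀ X Y)
    {a b c d : ℝ} (hdet : 0 < a * d - b * c) {B : ℝ} (hX : ∀ t ∈ I, |X t| ≤ B)
    (hb : ∀ t ∈ I, |c * X t + d * Y t| ≤ 1 / 2) :
    Reach I P₀ (fun t => a * X t + b * Y t) (fun t => c * X t + d * Y t) := by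
  by_cases hc : c = 0
  · subst hc
    have hd : d ≠ 0 := by rintro rfl; simp at hdet
    -- A preliminary reciprocal transformation moves the matrix into the cell `c ≠ 0`; `A` is small
    -- enough for `A * X` to be an admissible sine.
    have hA : 0 < 1 / (2 * (|B| + 1)) := by positivity
    set A := 1 / (2 * (|B| + 1)) with hA'
    have h1 := h.rotate hI hI' hA.ne' fun t ht => by
      rw [abs_mul, abs_of_pos hA, hA', div_mul_eq_mul_div, div_le_div_iff₀ (by positivity) two_pos]
      linarith [hX t ht, le_abs_self B]
    have h2 := h1.linear_of_ne_zero hI hI' (a := -(b / A)) (b := a / A) (c := -(d / A)) (d := 0)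
      (by
        have : 0 < a * d / (A * A) := by
          apply div_pos _ (by positivity)
          linarith
        calc _ < _ := this
          _ = _ := by field_simp; ring)
      (by simp [hd, hA.ne']) fun t ht => by
        convert hb t ht using 2
        field_simp
        ring
    exact h2.congr (fun t _ => by field_simp; ring) (fun t _ => by field_simp; ring)
  · exact h.linear_of_ne_zero hI hI' hdet hc hb

end Reach

end Profile

/-! ### From the model surface back to `S` -/

namespace RevolutionSurface

variable (S : RevolutionSurface)

theorem abs_lin_le {B : ℝ} (hB : ∀ t ∈ S.I, |S.ρ t| ≤ B) (c d : ℝ) {t : ℝ} (ht : t ∈ S.I) :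
    |c * S.ρ t + d * Real.sin (S.θ t)| ≤ |c| * B + |d| := by
  refine (abs_add_le _ _).trans ?_
  rw [abs_mul, abs_mul]
  gcongr
  · exact hB t ht
  · exact mul_le_of_le_one_right (abs_nonneg _) (Real.abs_sin_le_one _)

/-- If, in suitable linear coordinates, the relation between the distance to the axis and the sine
of the Gauss angle is that of a pure linear surface, then the surface is an image of it. -/
theorem exists_isPureLinear_of_radial {a b c d B ε lam : ℝ} {x : ℝ → ℝ} {F f : ℝ → ℝ}
    (hdet : 0 < a * d - b * c) (hB : ∀ t ∈ S.I, |S.ρ t| ≤ B) (hε : 0 < ε) (hF : Continuous F)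
    (hF' : ∀ r, |F r| ≤ 1 / 2) (hx : x = fun t => a * S.ρ t + b * Real.sin (S.θ t))
    (hFx : ∀ t ∈ S.I, F (x t) = ε * (c * S.ρ t + d * Real.sin (S.θ t)))
    (hx₀ : ∀ t ∈ S.I, 0 ≤ x t) (hxn : (x '' S.I).Nontrivial)
    (hf : ∀ r ∈ x '' S.I, HasDerivWithinAt F (f r) (x '' S.I) r) (hfc : ContinuousOn f (x '' S.I))
    (hlam : ∀ r ∈ x '' S.I, r * f r = lam * F r) (h0 : 0 ∈ x '' S.I → F 0 = 0 ∧ f 0 = 0) :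
    ∃ S₀ : RevolutionSurface, S₀.IsPureLinear lam ∧ S.IsImageOf S₀ := by
  have hxc : ContinuousOn x S.I := hx ▸ S.continuousOn_lin a b
  have hpos : ∀ r, √(1 - F r ^ 2) ≠ 0 := fun r =>
    (Real.sqrt_pos.2 (by nlinarith [abs_le.1 (hF' r)])).ne'
  obtain ⟨S₀, T, hT, hI, hS₀, hpure⟩ := exists_of_radial hF hF'
    (S.ordConnected_I.isPreconnected.image x hxc).ordConnected hxn (by simpa using hx₀) hf hfc hlam
    h0
  have hTc : Continuous T := continuous_iff_continuousAt.2 fun r => (hT r).continuousAt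
  have himage : (T ∘ x) '' S.I = S₀.I := by rw [image_comp, hI]
  refine ⟨S₀, hpure, T ∘ x, hTc.comp_continuousOn hxc, himage, ?_⟩
  have hfront : (S₀.toProfile.comp (T ∘ x)).IsFrontOn S.I := by
    refine S₀.isFrontOn_comp S.uniqueDiffOn
      (fun t ht => (hT (x t)).comp_hasDerivWithinAt t (hx ▸ S.hasDerivWithinAt_lin a b ht)) ?_
      fun t ht => himage ▸ mem_image_of_mem _ ht
    refine ContinuousOn.mul (ContinuousOn.inv₀ ?_ fun t _ => hpos _)
      (S.continuousOn_cos.mul (continuousOn_const.add (continuousOn_const.mul S.continuousOn_k₂)))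
    exact Real.continuous_sqrt.comp_continuousOn
      (continuousOn_const.sub ((hF.comp_continuousOn hxc).pow 2))
  have hreach : Profile.Reach S.I (S₀.toProfile.comp (T ∘ x)) x
      (fun t => ε * (c * S.ρ t + d * Real.sin (S.θ t))) :=
    ⟨fun t ht => (congrArg abs (hFx t ht)).symm.trans_le (hF' _), _, .refl, hfront, fun t ht =>
      ⟨(hS₀ (x t)).1, (hS₀ (x t)).2.trans (congrArg Real.arcsin (hFx t ht))⟩⟩
  have hxB : ∀ t ∈ S.I, |x t| ≤ |a| * B + |b| := fun t ht => hx ▸ S.abs_lin_le hB a b ht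
  set D := a * d - b * c with hD
  -- With this `A` the quantity `ρ / A` is at most `1 / 2` in absolute value.
  have hA : 0 < 2 * (|B| + 1) := by positivity
  set A := 2 * (|B| + 1) with hA'
  have hρ : ∀ t, -(d / (D * A)) * x t + b / (D * A * ε) *
      (ε * (c * S.ρ t + d * Real.sin (S.θ t))) = -(S.ρ t / A) := fun t => by
    rw [hx]
    field_simp
    rw [hD]
    ring
  have hs : ∀ t, -(c / (D * A)) * x t + a / (D * A * ε) *
      (ε * (c * S.ρ t + d * Real.sin (S.θ t))) = Real.sin (S.θ t) / A := fun t => by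
    rw [hx]
    field_simp
    rw [hD]
    ring
  -- The chain stops at `(sin θ / A, -ρ / A)`, one reciprocal transformation short of `S`. That last
  -- step prescribes only the sine, so it may end at the actual angle of `S` even where this leaves
  -- the arcsine branch.
  have hfinal := hreach.linear S.ordConnected_I S.uniqueDiffOn (a := -(c / (D * A)))
    (b := a / (D * A * ε)) (c := -(d / (D * A))) (d := b / (D * A * ε)) (by
      have : 0 < 1 / (D * A ^ 2 * ε) := by positivity
      calc _ < _ := this
        _ = _ := by
          field_simp
          rw [hD]
          ring) hxB fun t ht => by
      rw [hρ, abs_neg, abs_div, abs_of_pos hA, div_le_div_iff₀ hA two_pos]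
      linarith [hB t ht, le_abs_self B]
  refine hfinal.reciprocal hA.ne' S.isFrontOn (fun t _ => ?_) fun t _ => ?_
  · rw [hs]
    field_simp
  · rw [hρ]
    field_simp

/-- Rescaling an eigencoordinate makes it usable as the sine on the model surface. -/
theorem exists_scale {B : ℝ} (hB : ∀ t ∈ S.I, |S.ρ t| ≤ B) (c d : ℝ) :
    ∃ ε > 0, ∀ t ∈ S.I, |ε * (c * S.ρ t + d * Real.sin (S.θ t))| ≤ 1 / 2 := by
  obtain ⟨t₀, ht₀⟩ := S.nonempty_interior_I.mono interior_subset
  have hB₀ : 0 ≤ B := (abs_nonneg _).trans (hB t₀ ht₀)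
  refine ⟨1 / (2 * (|c| * B + |d| + 1)), by positivity, fun t ht => ?_⟩
  rw [abs_mul, abs_of_pos (by positivity), div_mul_eq_mul_div,
    div_le_div_iff₀ (by positivity) two_pos]
  linarith [S.abs_lin_le hB c d ht]

/-- The model has constant sine: a plane (`e = 0`, every `lam`) or a cone (`lam = 0`). A cone must
avoid its apex, whence `h0`. -/
theorem exists_isPureLinear_of_const {a b c d B e lam : ℝ} {x : ℝ → ℝ}
    (hdet : 0 < a * d - b * c) (hB : ∀ t ∈ S.I, |S.ρ t| ≤ B)
    (hx : x = fun t => a * S.ρ t + b * Real.sin (S.θ t))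
    (hy : ∀ t ∈ S.I, c * S.ρ t + d * Real.sin (S.θ t) = e)
    (hx₀ : ∀ t ∈ S.I, 0 ≤ x t) (hxn : (x '' S.I).Nontrivial) (he : e = 0 ∨ lam = 0)
    (h0 : ∀ t ∈ S.I, x t = 0 → e = 0) :
    ∃ S₀ : RevolutionSurface, S₀.IsPureLinear lam ∧ S.IsImageOf S₀ := by
  obtain ⟨ε, hε, hε'⟩ := S.exists_scale hB c d
  obtain ⟨t₀, ht₀⟩ := S.nonempty_interior_I.mono interior_subset
  refine S.exists_isPureLinear_of_radial (F := fun _ => ε * e) (f := fun _ => 0) hdet hB hε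
    continuous_const (fun _ => hy t₀ ht₀ ▸ hε' t₀ ht₀) hx (fun t ht => by rw [hy t ht]) hx₀ hxn
    (fun _ _ => hasDerivWithinAt_const _ _ _) continuousOn_const (fun r _ => ?_) ?_
  · rcases he with rfl | rfl <;> simp
  · rintro ⟨t, ht, hxt⟩
    simp [h0 t ht hxt]

/-- The function `r ^ lam` is `C¹` up to a pole `r = 0` when `1 < lam`; otherwise `x` has to stay
above a positive `m`. -/
theorem exists_isPureLinear_of_rpow {a b c d B K m lam : ℝ} {x : ℝ → ℝ}
    (hdet : 0 < a * d - b * c) (hB : ∀ t ∈ S.I, |S.ρ t| ≤ B)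
    (hx : x = fun t => a * S.ρ t + b * Real.sin (S.θ t))
    (hy : ∀ t ∈ S.I, c * S.ρ t + d * Real.sin (S.θ t) = K * x t ^ lam)
    (hm : 1 < lam ∧ m = 0 ∨ 0 < m)
    (hx₀ : ∀ t ∈ S.I, m ≤ x t) (hxn : (x '' S.I).Nontrivial) :
    ∃ S₀ : RevolutionSurface, S₀.IsPureLinear lam ∧ S.IsImageOf S₀ := by
  obtain ⟨ε, hε, hε'⟩ := S.exists_scale hB c d
  have hm₀ : 0 ≤ m := by rcases hm with h | h <;> linarith
  have hR : ∀ r ∈ x '' S.I, m ≤ r := by simpa using hx₀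
  -- The truncations make `F` continuous and bounded on the whole line without changing it on the
  -- range of `x`.
  set F : ℝ → ℝ := fun r => max (-(1 / 2)) (min (1 / 2) (ε * (K * max m r ^ lam))) with hF
  have hFR : ∀ r ∈ x '' S.I, F r = ε * (K * r ^ lam) := by
    rintro _ ⟨t, ht, rfl⟩
    have h1 := abs_le.1 (hε' t ht)
    rw [hy t ht] at h1
    simp only [hF]
    rw [max_eq_right (hx₀ t ht), min_eq_right h1.2, max_eq_right h1.1]
  have hne : ∀ r ∈ x '' S.I, r ≠ 0 ∨ 1 < lam := fun r hr => by
    rcases hm with h | h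
    · exact .inr h.1
    · exact .inl (h.trans_le (hR r hr)).ne'
  refine S.exists_isPureLinear_of_radial (F := F) (f := fun r => ε * (K * (lam * r ^ (lam - 1))))
    hdet hB hε ?_ (fun r => ?_) hx (fun t ht => ?_) (fun t ht => hm₀.trans (hx₀ t ht)) hxn
    (fun r hr => ?_) ?_ (fun r hr => ?_) fun hr => ?_
  · refine continuous_const.max (continuous_const.min (continuous_const.mul (continuous_const.mul
      ((continuous_const.max continuous_id).rpow_const fun r => ?_))))
    rcases hm with h | h
    · right; linarith
    · exact .inl (lt_max_of_lt_left h).ne'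
  · exact abs_le.2 ⟨le_max_left _ _, max_le (by norm_num) (min_le_left _ _)⟩
  · rw [hFR _ (mem_image_of_mem x ht), hy t ht]
  · refine HasDerivWithinAt.congr_of_mem ?_ hFR hr
    exact (((Real.hasDerivAt_rpow_const ((hne r hr).imp_right le_of_lt)).const_mul K).const_mul ε).hasDerivWithinAt
  · refine continuousOn_const.mul (continuousOn_const.mul (continuousOn_const.mul
      (continuousOn_id.rpow_const fun r hr => ?_)))
    rcases hne r hr with h | h
    · exact .inl h
    · right; linarith
  · rw [hFR r hr]
    rcases eq_or_ne r 0 with rfl | h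
    · rcases hne 0 hr with h | h
      · exact absurd rfl h
      · rw [Real.zero_rpow (show lam ≠ 0 by linarith)]
        ring
    · rw [Real.rpow_sub_one h]
      field_simp
  · rw [hFR 0 hr]
    rcases hm with h | h
    · rw [Real.zero_rpow (by linarith), Real.zero_rpow (by linarith)]
      simp
    · exact absurd (hR 0 hr) (not_le.2 h)

end RevolutionSurface

/-! ### The linear flow behind the Weingarten relation -/

/-- A function without zeros on an interval has constant sign. -/
theorem Set.OrdConnected.exists_sign {J : Set ℝ} (hJ : J.OrdConnected) {f : ℝ → ℝ}
    (hf : ContinuousOn f J) (h0 : ∀ t ∈ J, f t ≠ 0) :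
    ∃ τ : ℝ, τ * τ = 1 ∧ ∀ t ∈ J, 0 < τ * f t := by
  rcases J.eq_empty_or_nonempty with rfl | ⟨t₀, ht₀⟩
  · exact ⟨1, by simp⟩
  have hoc : (f '' J).OrdConnected := (hJ.isPreconnected.image f hf).ordConnected
  have hzero : (0 : ℝ) ∉ f '' J := by
    rintro ⟨t, ht, h⟩
    exact h0 t ht h
  rcases (h0 t₀ ht₀).lt_or_gt with h | h
  · refine ⟨-1, by norm_num, fun t ht => ?_⟩
    by_contra hneg
    exact hzero (hoc.out (mem_image_of_mem f ht₀) (mem_image_of_mem f ht) ⟨h.le, by linarith⟩)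
  · refine ⟨1, by norm_num, fun t ht => ?_⟩
    by_contra hneg
    exact hzero (hoc.out (mem_image_of_mem f ht) (mem_image_of_mem f ht₀) ⟨by linarith, h.le⟩)

theorem HasDerivWithinAt.eq_zero_of_eventually {I : Set ℝ} {f : ℝ → ℝ} {f' t : ℝ}
    (hI : UniqueDiffWithinAt ℝ I t) (hf : HasDerivWithinAt f f' I t) (ht : t ∈ I)
    (h : ∀ᶠ s in nhdsWithin t I, f s = 0) : f' = 0 :=
  hI.eq_deriv _ hf ((hasDerivWithinAt_const t I (0 : ℝ)).congr_of_eventuallyEq h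
    (h.self_of_nhdsWithin ht))

namespace RevolutionSurface

variable {S : RevolutionSurface} {α β γ δ : ℝ}

theorem ordConnected_interior (S : RevolutionSurface) : (interior S.I).OrdConnected :=
  S.ordConnected_I.convex.interior.ordConnected

/-- Multiplying the relation by `ρ` and using `ρ k₁ = sin θ` removes the singularity at poles. -/
theorem IsSemiQuadratic.k₂_mul (hS : S.IsSemiQuadratic α β γ δ) {t : ℝ} (ht : t ∈ S.I) :
    S.k₂ t * (α * Real.sin (S.θ t) + γ * S.ρ t) = -(β * Real.sin (S.θ t) + δ * S.ρ t) := by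
  rw [S.sin_eq_k₁_mul ht]
  linear_combination S.ρ t * hS t ht

theorem cos_eq_zero_of_not_nontrivial {a b : ℝ}
    (h : ¬ ((fun t => a * S.ρ t + b * Real.sin (S.θ t)) '' S.I).Nontrivial) {t : ℝ}
    (ht : t ∈ S.I) : Real.cos (S.θ t) * (a + b * S.k₂ t) = 0 := by
  refine (S.uniqueDiffOn t ht).eq_deriv _ (S.hasDerivWithinAt_lin a b ht) ?_
  refine (hasDerivWithinAt_const t S.I (a * S.ρ t + b * Real.sin (S.θ t))).congr_of_mem ?_ ht
  exact fun s hs => not_nontrivial_iff.1 h (mem_image_of_mem _ hs) (mem_image_of_mem _ ht)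

/-- If the relation is degenerate, then the profile curve has constant curvature. -/
theorem IsSemiQuadratic.exists_k₂_eq (hS : S.IsSemiQuadratic α β γ δ) (hdet : α * δ = β * γ)
    (hne : ¬ (α = 0 ∧ β = 0 ∧ γ = 0 ∧ δ = 0)) : ∃ k, ∀ t ∈ S.I, S.k₂ t = k := by
  have hfin : ∀ a b c d : ℝ, ¬ (a = 0 ∧ b = 0 ∧ c = 0 ∧ d = 0) →
      {X : ℝ | a * X + b = 0 ∧ c * X + d = 0}.Finite := fun a b c d h => by
    refine Set.Subsingleton.finite fun X hX Y hY => ?_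
    by_contra hXY
    have ha : a = 0 := by
      have : a * (X - Y) = 0 := by linear_combination hX.1 - hY.1
      exact (mul_eq_zero.1 this).resolve_right (sub_ne_zero.2 hXY)
    have hc : c = 0 := by
      have : c * (X - Y) = 0 := by linear_combination hX.2 - hY.2
      exact (mul_eq_zero.1 this).resolve_right (sub_ne_zero.2 hXY)
    exact h ⟨ha, by simpa [ha] using hX.1, hc, by simpa [hc] using hX.2⟩
  -- `k₂` is shown to take values in this finite set; being continuous on an interval, it is then
  -- constant.
  set Z : Set ℝ := {X | α * X + β = 0 ∧ γ * X + δ = 0} ∪ {X | α * X + γ = 0 ∧ β * X + δ = 0} ∪ {0}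
  have hZ : Z.Finite := ((hfin _ _ _ _ (by tauto)).union (hfin _ _ _ _ (by tauto))).union
    (finite_singleton 0)
  obtain ⟨t₀, ht₀⟩ := S.nonempty_interior_I.mono interior_subset
  have hmaps : MapsTo S.k₂ S.I Z := by
    intro t ht
    by_contra hk
    simp only [Z, mem_union, mem_ofPred_eq, mem_singleton_iff, not_or] at hk
    obtain ⟨⟨hk₁, hk₂⟩, hk₃⟩ := hk
    have hne : ∀ a b : ℝ, a * S.k₂ t + b ≠ 0 → ∀ᶠ s in nhdsWithin t S.I, a * S.k₂ s + b ≠ 0 :=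
      fun a b h => ((continuousOn_const.mul S.continuousOn_k₂).add continuousOn_const t ht
        ).eventually_ne h
    -- Degeneracy factors the relation: `α k₂ + β` and `γ k₂ + δ` both annihilate `αs + γρ`.
    have hM : ∀ᶠ s in nhdsWithin t S.I, γ * S.ρ s + α * Real.sin (S.θ s) = 0 := by
      rcases not_and_or.1 hk₁ with h | h
      · filter_upwards [hne _ _ h, self_mem_nhdsWithin] with s hs hsI
        refine (mul_eq_zero.1 ?_).resolve_left hs
        linear_combination α * hS.k₂_mul hsI - S.ρ s * hdet
      · filter_upwards [hne _ _ h, self_mem_nhdsWithin] with s hs hsI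
        refine (mul_eq_zero.1 ?_).resolve_left hs
        linear_combination γ * hS.k₂_mul hsI + Real.sin (S.θ s) * hdet
    -- Both `γρ + αs` and `δρ + βs` vanish near `t`; differentiate the one for which the factor next
    -- to `cos θ` is nonzero. A locally vertical profile then has `k₂ = 0`, which also lies in `Z`.
    have hcos : ∀ᶠ s in nhdsWithin t S.I, Real.cos (S.θ s) = 0 := by
      have hM' := eventually_eventually_nhdsWithin.2 hM
      rcases not_and_or.1 hk₂ with h | h
      · filter_upwards [hne _ _ h, self_mem_nhdsWithin, hM'] with s hs hsI hMs
        have := (S.hasDerivWithinAt_lin γ α hsI).eq_zero_of_eventually (S.uniqueDiffOn s hsI) hsI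
          hMs
        exact (mul_eq_zero.1 this).resolve_right fun h => hs (by linarith)
      · filter_upwards [hne _ _ h, self_mem_nhdsWithin, hM'] with s hs hsI hMs
        have := (S.hasDerivWithinAt_lin δ β hsI).eq_zero_of_eventually (S.uniqueDiffOn s hsI) hsI
          (by
            filter_upwards [hMs, self_mem_nhdsWithin] with r hr hrI
            linear_combination -S.k₂ r * hr + hS.k₂_mul hrI)
        exact (mul_eq_zero.1 this).resolve_right fun h => hs (by linarith)
    have h1 : -Real.sin (S.θ t) * S.k₂ t = 0 := (S.hasDerivWithinAt_θ ht).cos.eq_zero_of_eventually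
      (S.uniqueDiffOn t ht) ht hcos
    have h2 := Real.sin_sq_add_cos_sq (S.θ t)
    rw [hcos.self_of_nhdsWithin ht] at h2
    rcases mul_eq_zero.1 h1 with h | h
    · rw [neg_eq_zero.1 h] at h2; norm_num at h2
    · exact hk₃ h
  refine ⟨S.k₂ t₀, fun t ht => ?_⟩
  exact S.ordConnected_I.isPreconnected.constant_of_mapsTo hZ.isDiscrete S.continuousOn_k₂ hmaps ht
    ht₀

/-- If the sine of the Gauss angle is an affine function of the distance to the axis (plane, cone,
sphere or torus), then the surface is an image of a plane or of a cone. -/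
theorem exists_isPureLinear_of_affine {k e lam : ℝ} (hS : ¬ S.IsCylinder)
    (hs : ∀ t ∈ S.I, Real.sin (S.θ t) = k * S.ρ t + e) (he : e = 0 ∨ lam = 0) :
    ∃ S₀ : RevolutionSurface, S₀.IsPureLinear lam ∧ S.IsImageOf S₀ := by
  by_cases hk : k = 0
  · subst hk
    refine ⟨S, fun t ht => ?_, S.isImageOf_self⟩
    have hcos : ∀ t ∈ S.I, Real.cos (S.θ t) ≠ 0 := fun t ht h => hS fun s hs' => by
      have h1 := Real.sin_sq_add_cos_sq (S.θ t)
      have h2 := Real.sin_sq_add_cos_sq (S.θ s)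
      rw [hs t ht, h] at h1
      rw [hs s hs'] at h2
      refine pow_eq_zero_iff (two_ne_zero) |>.1 ?_
      linear_combination h2 - h1
    have hk₂ : S.k₂ t = 0 := by
      have := cos_eq_zero_of_not_nontrivial (S := S) (a := 0) (b := 1) (fun h => by
        obtain ⟨_, ⟨t, ht, rfl⟩, _, ⟨s, hs', rfl⟩, hne⟩ := h
        exact hne (by simp [hs t ht, hs s hs'])) ht
      simpa [hcos t ht] using this
    rw [hk₂]
    rcases he with rfl | rfl
    · unfold k₁
      rw [hk₂, hs t ht]
      simp
    · simp
  · obtain ⟨τ, hτ, hρ⟩ := S.ordConnected_interior.exists_sign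
      (S.continuousOn_ρ.mono interior_subset) S.ρ_ne_zero
    have hnonneg := S.ordConnected_I.nonneg_of_interior S.nonempty_interior_I
      (continuousOn_const.mul S.continuousOn_ρ) fun t ht => (hρ t ht).le
    have hτ0 : τ ≠ 0 := by rintro rfl; simp at hτ
    -- The coordinates are `x = |ρ|` and `y = τ (sin θ - k ρ) = τ e`; here `ρ` is bounded because `k
    -- ≠ 0`.
    refine S.exists_isPureLinear_of_const (a := τ) (b := 0) (c := -(τ * k)) (d := τ)
      (B := (1 + |e|) / |k|) (e := τ * e) (by linarith) (fun t ht => ?_) rfl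
      (fun t ht => by rw [hs t ht]; ring) (fun t ht => by simpa using hnonneg t ht) ?_
      (he.imp_left fun h => by rw [h, mul_zero]) fun t ht h => ?_
    · rw [le_div_iff₀ (abs_pos.2 hk), ← abs_mul]
      calc |S.ρ t * k| = |Real.sin (S.θ t) - e| := by rw [hs t ht]; congr 1; ring
        _ ≤ |Real.sin (S.θ t)| + |e| := abs_sub _ _
        _ ≤ _ := by gcongr; exact Real.abs_sin_le_one _
    · by_contra h
      exact hS fun t ht => by simpa [hτ0] using cos_eq_zero_of_not_nontrivial h ht
    · have h0 : S.ρ t = 0 := by simpa [hτ0] using h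
      have := hs t ht
      rw [S.sin_θ_eq_zero t ht h0, h0] at this
      rw [show e = 0 by linarith, mul_zero]

/-- `(a, b)` is a left eigenvector, with eigenvalue `μ`, of the linear vector field
`(αs + γρ, -βs - δρ)` whose trajectories `(ρ, s)`, with `s = sin θ`, are the solutions of the
semi-quadratic relation. -/
structure IsLeftEigen (α β γ δ a b μ : ℝ) : Prop where
  left : a * γ - b * δ = μ * a
  right : a * α - b * β = μ * b

theorem IsLeftEigen.smul {a b μ : ℝ} (h : IsLeftEigen α β γ δ a b μ) (c : ℝ) :
    IsLeftEigen α β γ δ (c * a) (c * b) μ :=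
  ⟨by linear_combination c * h.left, by linear_combination c * h.right⟩

/-- Up to the factor `cos θ / (αs + γρ)`, a left eigenvector gives a coordinate whose derivative is
`μ` times itself. -/
theorem IsSemiQuadratic.mul_lin {a b μ : ℝ} (hS : S.IsSemiQuadratic α β γ δ)
    (h : IsLeftEigen α β γ δ a b μ) {t : ℝ} (ht : t ∈ S.I) :
    (α * Real.sin (S.θ t) + γ * S.ρ t) * (a + b * S.k₂ t)
      = μ * (a * S.ρ t + b * Real.sin (S.θ t)) := by
  linear_combination b * hS.k₂_mul ht + S.ρ t * h.left + Real.sin (S.θ t) * h.right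

/-- If the first component of the field vanishes, so does the second by the relation; an invertible
matrix then forces `(ρ, s) = 0`. -/
theorem IsSemiQuadratic.speed_ne_zero (hS : S.IsSemiQuadratic α β γ δ) (hdet : α * δ ≠ β * γ)
    {t : ℝ} (ht : t ∈ S.I) (hρ : S.ρ t ≠ 0) : α * Real.sin (S.θ t) + γ * S.ρ t ≠ 0 := fun h => by
  have h1 := hS.k₂_mul ht
  rw [h] at h1
  have : (α * δ - β * γ) * S.ρ t = 0 := by linear_combination -β * h + α * h1
  exact (mul_ne_zero (sub_ne_zero.2 hdet) hρ) this

/-- `G` is the time of the linear flow, common to all eigencoordinates; it may run back and forth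
with the sign of `cos θ`. -/
theorem IsSemiQuadratic.exists_exp (hS : S.IsSemiQuadratic α β γ δ) (hdet : α * δ ≠ β * γ) :
    ∃ G : ℝ → ℝ, ∀ a b μ, IsLeftEigen α β γ δ a b μ → ∃ C : ℝ, ∀ t ∈ interior S.I,
      a * S.ρ t + b * Real.sin (S.θ t) = C * Real.exp (μ * G t) := by
  have hne : ∀ t ∈ interior S.I, α * Real.sin (S.θ t) + γ * S.ρ t ≠ 0 := fun t ht =>
    hS.speed_ne_zero hdet (interior_subset ht) (S.ρ_ne_zero t ht)
  have hcont : ContinuousOn (fun t => Real.cos (S.θ t) / (α * Real.sin (S.θ t) + γ * S.ρ t))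
      (interior S.I) :=
    (S.continuousOn_cos.mono interior_subset).div (((continuousOn_const.mul S.continuousOn_sin).add
      (continuousOn_const.mul S.continuousOn_ρ)).mono interior_subset) hne
  obtain ⟨G, hG⟩ := hcont.exists_hasDerivWithinAt S.ordConnected_interior
  refine ⟨G, fun a b μ h => ?_⟩
  obtain ⟨t₀, ht₀⟩ := S.nonempty_interior_I
  have hder : ∀ t ∈ interior S.I, HasDerivWithinAt
      (fun t => (a * S.ρ t + b * Real.sin (S.θ t)) * Real.exp (-(μ * G t))) 0 (interior S.I) t := by
    intro t ht
    have h1 := ((S.hasDerivWithinAt_lin a b (interior_subset ht)).mono interior_subset).mul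
      ((hG t ht).const_mul μ).neg.exp
    refine h1.congr_deriv ?_
    have h2 := hS.mul_lin h (interior_subset ht)
    have h3 := hne t ht
    set M := α * Real.sin (S.θ t) + γ * S.ρ t
    have h4 : a + b * S.k₂ t = μ * (a * S.ρ t + b * Real.sin (S.θ t)) / M := by
      rw [eq_div_iff h3]
      linear_combination h2
    rw [h4]
    ring
  refine ⟨(a * S.ρ t₀ + b * Real.sin (S.θ t₀)) * Real.exp (-(μ * G t₀)), fun t ht => ?_⟩
  have := S.ordConnected_interior.eq_of_hasDerivWithinAt_zero hder ht₀ ht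
  rw [this, mul_assoc, ← Real.exp_add]
  simp

/-- A trajectory on an eigenline has `sin θ` proportional to `ρ`; the model is a plane, which
satisfies `k₂ = lam * k₁` for every `lam`. -/
theorem exists_isPureLinear_of_lin_eq_zero {a b : ℝ} (hab : ¬ (a = 0 ∧ b = 0))
    (hS : ¬ S.IsCylinder) (h : ∀ t ∈ interior S.I, a * S.ρ t + b * Real.sin (S.θ t) = 0)
    (lam : ℝ) : ∃ S₀ : RevolutionSurface, S₀.IsPureLinear lam ∧ S.IsImageOf S₀ := by
  have h' := S.ordConnected_I.eqOn_of_interior S.nonempty_interior_I (S.continuousOn_lin a b)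
    continuousOn_const h
  obtain ⟨t₀, ht₀⟩ := S.nonempty_interior_I
  have hb : b ≠ 0 := by
    rintro rfl
    have := h t₀ ht₀
    simp only [zero_mul, add_zero, mul_eq_zero, S.ρ_ne_zero t₀ ht₀, or_false] at this
    exact hab ⟨this, rfl⟩
  refine exists_isPureLinear_of_affine (k := -(a / b)) (e := 0) hS (fun t ht => ?_) (.inl rfl)
  have := h' ht
  simp only at this
  field_simp
  linarith

/-- In eigencoordinates `x`, `y` the profile curve is given by a power law `y = K x ^ lam`, unless
one of them vanishes. -/
theorem IsSemiQuadratic.exists_rpow (hS : S.IsSemiQuadratic α β γ δ) (hdet : α * δ ≠ β * γ)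
    (hcyl : ¬ S.IsCylinder) {a b c d μ₁ μ₂ : ℝ} (hab : IsLeftEigen α β γ δ a b μ₁)
    (hcd : IsLeftEigen α β γ δ c d μ₂) (habcd : 0 < a * d - b * c) (hμ : μ₁ ≠ 0) :
    (∀ lam, ∃ S₀ : RevolutionSurface, S₀.IsPureLinear lam ∧ S.IsImageOf S₀) ∨
    ∃ τ K : ℝ, τ * τ = 1 ∧ K ≠ 0 ∧ ∀ t ∈ interior S.I,
      0 < τ * a * S.ρ t + τ * b * Real.sin (S.θ t) ∧
      τ * c * S.ρ t + τ * d * Real.sin (S.θ t)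
        = K * (τ * a * S.ρ t + τ * b * Real.sin (S.θ t)) ^ (μ₂ / μ₁) := by
  obtain ⟨G, hG⟩ := hS.exists_exp hdet
  obtain ⟨X, hX⟩ := hG a b μ₁ hab
  obtain ⟨Y, hY⟩ := hG c d μ₂ hcd
  by_cases hX0 : X = 0
  · exact .inl (exists_isPureLinear_of_lin_eq_zero (a := a) (b := b)
      (fun h => by simp [h] at habcd) hcyl
      fun t ht => by rw [hX t ht, hX0, zero_mul])
  by_cases hY0 : Y = 0
  · exact .inl (exists_isPureLinear_of_lin_eq_zero (a := c) (b := d)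
      (fun h => by simp [h] at habcd) hcyl
      fun t ht => by rw [hY t ht, hY0, zero_mul])
  -- Flipping the sign of both coordinates makes `x` positive and keeps the determinant.
  obtain ⟨τ, hτ, hτX⟩ : ∃ τ : ℝ, τ * τ = 1 ∧ 0 < τ * X := by
    rcases lt_or_gt_of_ne hX0 with h | h
    · exact ⟨-1, by norm_num, by linarith⟩
    · exact ⟨1, by norm_num, by linarith⟩
  have hτ0 : τ ≠ 0 := by rintro rfl; simp at hτ
  have hXl : (τ * X) ^ (μ₂ / μ₁) ≠ 0 := (Real.rpow_pos_of_pos hτX _).ne'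
  have hx : ∀ t ∈ interior S.I, τ * a * S.ρ t + τ * b * Real.sin (S.θ t)
      = τ * X * Real.exp (μ₁ * G t) := fun t ht => by linear_combination τ * hX t ht
  refine .inr ⟨τ, τ * Y / (τ * X) ^ (μ₂ / μ₁), hτ, by positivity, fun t ht => ⟨?_, ?_⟩⟩
  · rw [hx t ht]
    positivity
  · rw [hx t ht, Real.mul_rpow hτX.le (Real.exp_pos _).le, ← Real.exp_mul]
    have h1 : μ₁ * G t * (μ₂ / μ₁) = μ₂ * G t := by field_simp
    rw [h1]
    field_simp
    linear_combination hY t ht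

end RevolutionSurface

/-! ### Arc-length reparametrization of parallel surfaces -/

/-- A function with positive continuous derivative on an interval has a differentiable inverse. -/
theorem Set.OrdConnected.exists_inverse_of_pos {I : Set ℝ} (hI : I.OrdConnected)
    {w : ℝ → ℝ} (hw : ContinuousOn w I) (hpos : ∀ t ∈ I, 0 < w t) :
    ∃ σ g : ℝ → ℝ, (∀ t ∈ I, HasDerivWithinAt σ (w t) I t) ∧ (∀ t ∈ I, g (σ t) = t) ∧
      ∀ t ∈ I, HasDerivWithinAt g (w t)⁻¹ (σ '' I) (σ t) := by
  obtain ⟨σ, hσ⟩ := hw.exists_hasDerivWithinAt hI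
  have hσc : ContinuousOn σ I := fun t ht => (hσ t ht).continuousWithinAt
  have hmono : StrictMonoOn σ I := by
    refine strictMonoOn_of_deriv_pos hI.convex hσc fun t ht => ?_
    rw [((hσ t (interior_subset ht)).hasDerivAt (mem_interior_iff_mem_nhds.1 ht)).deriv]
    exact hpos t (interior_subset ht)
  have hJ : (σ '' I).OrdConnected := (hI.isPreconnected.image σ hσc).ordConnected
  have hinv : ∀ t ∈ I, Function.invFunOn σ I (σ t) = t := fun t ht =>
    hmono.injOn.leftInvOn_invFunOn ht
  refine ⟨σ, Function.invFunOn σ I, hσ, hinv, fun t ht => ?_⟩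
  have hg : ContinuousOn (Function.invFunOn σ I) (σ '' I) := by
    rw [continuousOn_iff_continuous_domRestrict]
    refine (continuous_subtype_val.comp (hmono.orderIso σ I).symm.continuous).congr fun y => ?_
    obtain ⟨⟨s, hs⟩, rfl⟩ := (hmono.orderIso σ I).surjective y
    simp only [Function.comp_apply, OrderIso.symm_apply_apply, domRestrict_apply]
    exact (hinv s hs).symm
  have hmaps : MapsTo (Function.invFunOn σ I) (σ '' I) I := by
    rintro _ ⟨s, hs, rfl⟩
    rwa [hinv s hs]
  have hσt := mem_image_of_mem σ ht
  have hf : HasFDerivWithinAt σ (ContinuousLinearEquiv.unitsEquivAut ℝ (Units.mk0 (w t)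
      (hpos t ht).ne') : ℝ →L[ℝ] ℝ) I (Function.invFunOn σ I (σ t)) := by
    rw [hinv t ht]
    exact (hσ t ht).hasFDerivWithinAt
  have hgf := hf.of_local_left_inverse ((hg _ hσt).tendsto_nhdsWithin hmaps) hσt (by
    filter_upwards [self_mem_nhdsWithin] with u hu
    obtain ⟨s, hs, rfl⟩ := hu
    rw [hinv s hs])
  simpa using hgf.hasDerivWithinAt

theorem Set.OrdConnected.exists_inverse {I : Set ℝ} (hI : I.OrdConnected)
    {w : ℝ → ℝ} (hw : ContinuousOn w I) (h0 : ∀ t ∈ I, w t ≠ 0) :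
    ∃ σ g : ℝ → ℝ, (∀ t ∈ I, HasDerivWithinAt σ (w t) I t) ∧ (∀ t ∈ I, g (σ t) = t) ∧
      ∀ t ∈ I, HasDerivWithinAt g (w t)⁻¹ (σ '' I) (σ t) := by
  obtain ⟨τ, hτ, hpos⟩ := hI.exists_sign hw h0
  obtain ⟨σ, g, hσ, hg, hg'⟩ := hI.exists_inverse_of_pos (w := fun t => τ * w t)
    (continuousOn_const.mul hw) hpos
  have hττ : ∀ x, τ * (τ * x) = x := fun x => by rw [← mul_assoc, hτ, one_mul]
  have hτ0 : τ ≠ 0 := by rintro rfl; simp at hτ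
  refine ⟨fun t => τ * σ t, fun u => g (τ * u), fun t ht => ?_, fun t ht => ?_, fun t ht => ?_⟩
  · exact ((hσ t ht).const_mul τ).congr_deriv (hττ _)
  · simp only [hττ, hg t ht]
  · have h1 : HasDerivWithinAt (fun u => τ * u) τ ((fun t => τ * σ t) '' I) (τ * σ t) := by
      simpa using (hasDerivWithinAt_id (τ * σ t) ((fun t => τ * σ t) '' I)).const_mul τ
    have h2 : MapsTo (fun u => τ * u) ((fun t => τ * σ t) '' I) (σ '' I) := by
      rintro _ ⟨s, hs, rfl⟩
      simp only [hττ]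
      exact mem_image_of_mem σ hs
    have h3 := HasDerivWithinAt.comp (τ * σ t) ((hττ (σ t)).symm ▸ hg' t ht) h1 h2
    refine h3.congr_deriv ?_
    have := h0 t ht
    field_simp

namespace RevolutionSurface

variable {S : RevolutionSurface} {α β γ δ : ℝ}

/-- Parallel surfaces without singularities, reparametrized by arc length. -/
theorem exists_isPureLinear_of_parallel {v lam : ℝ} (hw : ∀ t ∈ S.I, 1 + v * S.k₂ t ≠ 0)
    (hx : ∀ t ∈ S.I, S.ρ t + v * Real.sin (S.θ t) ≠ 0)
    (hlam : ∀ t ∈ S.I, S.k₂ t * (S.ρ t + v * Real.sin (S.θ t))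
      = lam * Real.sin (S.θ t) * (1 + v * S.k₂ t)) :
    ∃ S₀ : RevolutionSurface, S₀.IsPureLinear lam ∧ S.IsImageOf S₀ := by
  have hwc : ContinuousOn (fun t => 1 + v * S.k₂ t) S.I :=
    continuousOn_const.add (continuousOn_const.mul S.continuousOn_k₂)
  obtain ⟨σ, g, hσ, hg, hg'⟩ := S.ordConnected_I.exists_inverse hwc hw
  have hσc : ContinuousOn σ S.I := fun t ht => (hσ t ht).continuousWithinAt
  have hgI : MapsTo g (σ '' S.I) S.I := by
    rintro _ ⟨s, hs, rfl⟩
    rwa [hg s hs]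
  have hgc : ContinuousOn g (σ '' S.I) := by
    rintro _ ⟨s, hs, rfl⟩
    exact (hg' s hs).continuousWithinAt
  have hJ : (σ '' S.I).OrdConnected := (S.ordConnected_I.isPreconnected.image σ hσc).ordConnected
  have hJ' : (interior (σ '' S.I)).Nonempty := by
    have hnt : (σ '' S.I).Nontrivial := by
      have : (interior S.I).Nontrivial :=
        (infinite_of_mem_nhds _ (isOpen_interior.mem_nhds S.nonempty_interior_I.some_mem)).nontrivial
      exact ((this.mono interior_subset).image_of_injOn fun s hs t ht h => by
        rw [← hg s hs, ← hg t ht, h])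
    obtain ⟨r₀, h₀, r₁, h₁, hlt⟩ := hnt.exists_lt
    refine Nonempty.mono (interior_mono (hJ.out h₀ h₁)) ?_
    rw [interior_Icc]
    exact nonempty_Ioo.2 hlt
  have hρ : ∀ t ∈ S.I, HasDerivWithinAt (fun t => S.ρ t + v * Real.sin (S.θ t))
      (Real.cos (S.θ t) * (1 + v * S.k₂ t)) S.I t := fun t ht => by
    simpa using S.hasDerivWithinAt_lin 1 v ht
  have hh : ∀ t ∈ S.I, HasDerivWithinAt (fun t => S.h t + v * Real.cos (S.θ t))
      (-Real.sin (S.θ t) * (1 + v * S.k₂ t)) S.I t := fun t ht =>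
    ((S.hasDerivWithinAt_h t ht).add ((S.hasDerivWithinAt_θ ht).cos.const_mul v)).congr_deriv
      (by ring)
  have hcomp : ∀ {f f' : ℝ → ℝ}, (∀ t ∈ S.I, HasDerivWithinAt f (f' t * (1 + v * S.k₂ t)) S.I t) →
      ∀ u ∈ σ '' S.I, HasDerivWithinAt (fun u => f (g u)) (f' (g u)) (σ '' S.I) u := by
    rintro f f' hf _ ⟨s, hs, rfl⟩
    have h1 : HasDerivWithinAt f (f' s * (1 + v * S.k₂ s)) S.I (g (σ s)) := by
      rw [hg s hs]
      exact hf s hs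
    refine (h1.comp (σ s) (hg' s hs) hgI).congr_deriv ?_
    rw [hg s hs]
    have := hw s hs
    field_simp
  have hθ := hcomp (f := S.θ) (f' := fun t => S.k₂ t / (1 + v * S.k₂ t)) fun t ht =>
    (S.hasDerivWithinAt_θ ht).congr_deriv (div_mul_cancel₀ _ (hw t ht)).symm
  let S₀ : RevolutionSurface :=
    { ρ := fun u => S.ρ (g u) + v * Real.sin (S.θ (g u))
      h := fun u => S.h (g u) + v * Real.cos (S.θ (g u))
      θ := fun u => S.θ (g u)
      I := σ '' S.I
      ordConnected_I := hJ
      nonempty_interior_I := hJ'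
      hasDerivWithinAt_ρ := hcomp (f' := fun t => Real.cos (S.θ t)) hρ
      hasDerivWithinAt_h := hcomp (f' := fun t => -Real.sin (S.θ t)) hh
      contDiffOn_θ := contDiffOn_one_of_hasDerivWithinAt (hJ.uniqueDiffOn hJ') hθ
        ((S.continuousOn_k₂.div hwc hw).comp hgc hgI)
      ρ_ne_zero := fun t ht => hx _ (hgI (interior_subset ht))
      sin_θ_eq_zero := fun t ht h => absurd h (hx _ (hgI ht)) }
  refine ⟨S₀, fun u hu => ?_, σ, hσc, rfl, .single ⟨?_, S.isFrontOn, .inr (.inl ⟨-v, ?_⟩)⟩⟩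
  · have h1 : S₀.k₂ u = S.k₂ (g u) / (1 + v * S.k₂ (g u)) :=
      (hθ u hu).derivWithin (S₀.uniqueDiffOn u hu)
    have h2 := hw _ (hgI hu)
    have h3 := hx _ (hgI hu)
    have h4 : S₀.k₁ u = Real.sin (S.θ (g u)) / (S.ρ (g u) + v * Real.sin (S.θ (g u))) :=
      if_neg h3
    rw [h1, h4, div_eq_iff h2, mul_assoc, div_mul_eq_mul_div, ← mul_div_assoc, eq_div_iff h3,
      hlam _ (hgI hu), mul_assoc]
  · exact S₀.isFrontOn_comp S.uniqueDiffOn hσ hwc fun t ht => mem_image_of_mem σ ht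
  · intro t ht
    simp only [Profile.comp, Function.comp_apply, S₀, hg t ht]
    refine ⟨by ring, by ring, trivial⟩

end RevolutionSurface

/-! ### Eigenvectors and bounds on the distance to the axis -/

namespace RevolutionSurface

variable {S : RevolutionSurface} {α β γ δ : ℝ}

theorem exists_isLeftEigen {μ : ℝ} (hμ : (μ - γ) * (μ + β) + α * δ = 0) :
    ∃ a b, IsLeftEigen α β γ δ a b μ ∧ ¬ (a = 0 ∧ b = 0) := by
  -- Each of the two eigenvector equations suggests a solution, `(δ, γ - μ)` or `(β + μ, α)`; if
  -- both vanish, the matrix is scalar.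
  by_cases h1 : δ = 0 ∧ γ - μ = 0
  · by_cases h2 : β + μ = 0 ∧ α = 0
    · exact ⟨1, 0, ⟨by linear_combination h1.2, by linear_combination h2.2⟩, by simp⟩
    · exact ⟨β + μ, α, ⟨by linear_combination -hμ, by ring⟩, h2⟩
  · exact ⟨δ, γ - μ, ⟨by ring, by linear_combination hμ⟩, h1⟩

theorem IsLeftEigen.det_ne_zero {a b c d μ₁ μ₂ : ℝ} (hab : IsLeftEigen α β γ δ a b μ₁)
    (hcd : IsLeftEigen α β γ δ c d μ₂) (hab0 : ¬ (a = 0 ∧ b = 0)) (hcd0 : ¬ (c = 0 ∧ d = 0))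
    (hμ : μ₁ ≠ μ₂) : a * d - b * c ≠ 0 := fun h => by
  have h1 : (μ₁ - μ₂) * (a * c) = 0 := by
    linear_combination -c * hab.left + a * hcd.left + δ * h
  have h2 : (μ₁ - μ₂) * (b * d) = 0 := by
    linear_combination -d * hab.right + b * hcd.right + α * h
  have h3 := (mul_eq_zero.1 h1).resolve_left (sub_ne_zero.2 hμ)
  have h4 := (mul_eq_zero.1 h2).resolve_left (sub_ne_zero.2 hμ)
  rcases mul_eq_zero.1 h3 with rfl | rfl
  · have hb : b ≠ 0 := fun h => hab0 ⟨rfl, h⟩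
    have hd := (mul_eq_zero.1 h4).resolve_left hb
    have : b * c = 0 := by linear_combination -h
    exact hcd0 ⟨(mul_eq_zero.1 this).resolve_left hb, hd⟩
  · have hd : d ≠ 0 := fun h => hcd0 ⟨rfl, h⟩
    have hb := (mul_eq_zero.1 h4).resolve_right hd
    have : a * d = 0 := by linear_combination h
    exact hab0 ⟨(mul_eq_zero.1 this).resolve_right hd, hb⟩

theorem exists_isLeftEigen_pair {μ₁ μ₂ : ℝ} (h₁ : (μ₁ - γ) * (μ₁ + β) + α * δ = 0)
    (h₂ : (μ₂ - γ) * (μ₂ + β) + α * δ = 0) (hμ : μ₁ ≠ μ₂) :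
    ∃ a b c d, IsLeftEigen α β γ δ a b μ₁ ∧ IsLeftEigen α β γ δ c d μ₂ ∧ 0 < a * d - b * c := by
  obtain ⟨a, b, hab, hab0⟩ := exists_isLeftEigen h₁
  obtain ⟨c, d, hcd, hcd0⟩ := exists_isLeftEigen h₂
  rcases lt_or_gt_of_ne (hab.det_ne_zero hcd hab0 hcd0 hμ) with h | h
  · exact ⟨a, b, -1 * c, -1 * d, hab, hcd.smul _, by linarith⟩
  · exact ⟨a, b, c, d, hab, hcd, h⟩

/-- The eigenvalues of the linear vector field are real and distinct. -/
theorem exists_eigenvalues (hΛ : 0 < Lambda₂ α β γ δ) :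
    ∃ μ₁ μ₂ : ℝ, (μ₁ - γ) * (μ₁ + β) + α * δ = 0 ∧ (μ₂ - γ) * (μ₂ + β) + α * δ = 0 ∧ μ₁ ≠ μ₂ ∧
      μ₁ * μ₂ = α * δ - β * γ := by
  have h := Real.mul_self_sqrt hΛ.le
  have hpos := Real.sqrt_pos.2 hΛ
  set w := √(Lambda₂ α β γ δ)
  unfold Lambda₂ at h
  refine ⟨(γ - β - w) / 2, (γ - β + w) / 2, ?_, ?_, ?_, ?_⟩
  · linear_combination h / 4
  · linear_combination h / 4
  · intro h
    linarith
  · linear_combination -h / 4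

/-- The coordinate `x` could be constant only with `cos θ = 0` or `a + b k₂ = 0`; the latter
contradicts `μ₁ x ≠ 0`. -/
theorem nontrivial_image_of_lin_pos {a b μ₁ : ℝ} (hS : S.IsSemiQuadratic α β γ δ)
    (hcyl : ¬ S.IsCylinder) (hab : IsLeftEigen α β γ δ a b μ₁) (hμ : μ₁ ≠ 0)
    (hx : ∀ t ∈ interior S.I, 0 < a * S.ρ t + b * Real.sin (S.θ t)) :
    ((fun t => a * S.ρ t + b * Real.sin (S.θ t)) '' S.I).Nontrivial := by
  by_contra h
  refine hcyl (S.ordConnected_I.eqOn_of_interior S.nonempty_interior_I S.continuousOn_cos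
    continuousOn_const fun t ht => ?_)
  refine (mul_eq_zero.1 (cos_eq_zero_of_not_nontrivial h (interior_subset ht))).resolve_right
    fun h0 => ?_
  have := hS.mul_lin hab (interior_subset ht)
  rw [h0, mul_zero] at this
  exact mul_ne_zero hμ (hx t ht).ne' this.symm

theorem abs_ρ_le_of_interior {B : ℝ} (hB : ∀ t ∈ interior S.I, |S.ρ t| ≤ B) :
    ∀ t ∈ S.I, |S.ρ t| ≤ B := fun t ht => by
  have := S.ordConnected_I.nonneg_of_interior S.nonempty_interior_I
    (continuousOn_const.sub S.continuousOn_ρ.abs) (fun t ht => sub_nonneg.2 (hB t ht)) t ht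
  exact sub_nonneg.1 this

/-- Bounds on linear coordinates bound the distance to the axis. -/
theorem exists_abs_ρ_le {a b c d X Y : ℝ} (hdet : a * d - b * c ≠ 0)
    (hX : ∀ t ∈ interior S.I, |a * S.ρ t + b * Real.sin (S.θ t)| ≤ X)
    (hY : ∀ t ∈ interior S.I, |c * S.ρ t + d * Real.sin (S.θ t)| ≤ Y) :
    ∃ B, ∀ t ∈ S.I, |S.ρ t| ≤ B := by
  refine ⟨(|d| * X + |b| * Y) / |a * d - b * c|, abs_ρ_le_of_interior fun t ht => ?_⟩
  rw [le_div_iff₀ (abs_pos.2 hdet), ← abs_mul]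
  calc |S.ρ t * (a * d - b * c)| = |d * (a * S.ρ t + b * Real.sin (S.θ t))
        - b * (c * S.ρ t + d * Real.sin (S.θ t))| := by congr 1; ring
    _ ≤ |d * (a * S.ρ t + b * Real.sin (S.θ t))| + |b * (c * S.ρ t + d * Real.sin (S.θ t))| :=
      abs_sub _ _
    _ ≤ _ := by
      rw [abs_mul, abs_mul]
      gcongr
      · exact hX t ht
      · exact hY t ht

/-- The sine of the Gauss angle in linear coordinates `x`, `y` is bounded. -/
theorem abs_sub_le_det (S : RevolutionSurface) {a b c d : ℝ} (hdet : 0 < a * d - b * c) (t : ℝ) :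
    |a * (c * S.ρ t + d * Real.sin (S.θ t)) - c * (a * S.ρ t + b * Real.sin (S.θ t))|
      ≤ a * d - b * c := by
  have h1 : a * (c * S.ρ t + d * Real.sin (S.θ t)) - c * (a * S.ρ t + b * Real.sin (S.θ t))
      = (a * d - b * c) * Real.sin (S.θ t) := by ring
  rw [h1, abs_mul, abs_of_pos hdet]
  exact mul_le_of_le_one_right hdet.le (Real.abs_sin_le_one _)

/-- Superlinear growth of `y = K x ^ lam` is incompatible with `|a y - c x| ≤ a d - b c` for large
`x` if `a ≠ 0`; if `a = 0`, then `x` is a multiple of `sin θ`. So `ρ` is bounded. -/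
theorem exists_isPureLinear_of_one_lt {a b c d K lam : ℝ} (hdet : 0 < a * d - b * c)
    (hlam : 1 < lam) (hK : K ≠ 0)
    (hpow : ∀ t ∈ interior S.I, 0 < a * S.ρ t + b * Real.sin (S.θ t) ∧
      c * S.ρ t + d * Real.sin (S.θ t) = K * (a * S.ρ t + b * Real.sin (S.θ t)) ^ lam)
    (hn : ((fun t => a * S.ρ t + b * Real.sin (S.θ t)) '' S.I).Nontrivial) :
    ∃ S₀ : RevolutionSurface, S₀.IsPureLinear lam ∧ S.IsImageOf S₀ := by
  obtain ⟨X, hX⟩ : ∃ X, ∀ t ∈ interior S.I, a * S.ρ t + b * Real.sin (S.θ t) ≤ X := by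
    by_cases ha : a = 0
    · subst ha
      exact ⟨|b|, fun t _ => by
        rw [zero_mul, zero_add]
        refine (le_abs_self _).trans ?_
        rw [abs_mul]
        exact mul_le_of_le_one_right (abs_nonneg _) (Real.abs_sin_le_one _)⟩
    · set D := a * d - b * c with hD
      refine ⟨max 1 (((D + |c|) / |a * K|) ^ (lam - 1)⁻¹), fun t ht => ?_⟩
      have hd := S.abs_sub_le_det hdet t
      rw [(hpow t ht).2] at hd
      have hx := (hpow t ht).1
      set x := a * S.ρ t + b * Real.sin (S.θ t)
      rcases le_or_gt x 1 with h1 | h1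
      · exact h1.trans (le_max_left _ _)
      refine le_trans ?_ (le_max_right _ _)
      have h2 : |a * K| * x ^ lam ≤ D + |c| * x := by
        calc |a * K| * x ^ lam = |a * (K * x ^ lam)| := by
              rw [← mul_assoc, abs_mul (a * K), abs_of_pos (Real.rpow_pos_of_pos hx _)]
          _ = |(a * (K * x ^ lam) - c * x) + c * x| := by rw [sub_add_cancel]
          _ ≤ |a * (K * x ^ lam) - c * x| + |c * x| := abs_add_le _ _
          _ ≤ D + |c| * x := by rw [abs_mul c, abs_of_pos hx]; gcongr
      have haK : 0 < |a * K| := abs_pos.2 (mul_ne_zero ha hK)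
      have h3 : x ^ (lam - 1) ≤ (D + |c|) / |a * K| := by
        rw [le_div_iff₀ haK, Real.rpow_sub_one hx.ne', div_mul_eq_mul_div, div_le_iff₀ hx]
        nlinarith
      calc x = (x ^ (lam - 1)) ^ (lam - 1)⁻¹ := by
            rw [← Real.rpow_mul hx.le, mul_inv_cancel₀ (by linarith), Real.rpow_one]
        _ ≤ _ := Real.rpow_le_rpow (Real.rpow_pos_of_pos hx _).le h3
            (inv_nonneg.2 (by linarith))
  obtain ⟨B, hB⟩ := S.exists_abs_ρ_le hdet.ne' (X := X) (Y := |K| * X ^ lam)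
    (fun t ht => by rw [abs_of_pos (hpow t ht).1]; exact hX t ht)
    (fun t ht => by
      rw [(hpow t ht).2, abs_mul, abs_of_pos (Real.rpow_pos_of_pos (hpow t ht).1 _)]
      gcongr
      · exact (hpow t ht).1.le
      · exact hX t ht)
  refine S.exists_isPureLinear_of_rpow hdet hB rfl
    (S.ordConnected_I.eqOn_of_interior S.nonempty_interior_I (S.continuousOn_lin c d)
      (continuousOn_const.mul ((S.continuousOn_lin a b).rpow_const fun _ _ => ?_))
      fun t ht => (hpow t ht).2) (.inl ⟨hlam, rfl⟩)
    (S.ordConnected_I.nonneg_of_interior S.nonempty_interior_I (S.continuousOn_lin a b)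
      fun t ht => (hpow t ht).1.le) hn
  right
  linarith

/-- On a hyperbola-like curve `y` is bounded where `x ≥ 1`, and elsewhere by the strip `|a y - c x|
≤ a d - b c` as `a ≠ 0`; the strip then bounds `x` as `c ≠ 0`. The bound on `y` in turn keeps `x`
away from zero. -/
theorem exists_isPureLinear_of_neg {a b c d K lam : ℝ} (hdet : 0 < a * d - b * c)
    (ha : a ≠ 0) (hc : c ≠ 0) (hlam : lam < 0) (hK : K ≠ 0)
    (hpow : ∀ t ∈ interior S.I, 0 < a * S.ρ t + b * Real.sin (S.θ t) ∧
      c * S.ρ t + d * Real.sin (S.θ t) = K * (a * S.ρ t + b * Real.sin (S.θ t)) ^ lam)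
    (hn : ((fun t => a * S.ρ t + b * Real.sin (S.θ t)) '' S.I).Nontrivial) :
    ∃ S₀ : RevolutionSurface, S₀.IsPureLinear lam ∧ S.IsImageOf S₀ := by
  have hK' : 0 < |K| := abs_pos.2 hK
  have ha' : 0 < |a| := abs_pos.2 ha
  have hc' : 0 < |c| := abs_pos.2 hc
  set D := a * d - b * c with hD
  have hYpos : 0 < max |K| ((D + |c|) / |a|) := lt_max_of_lt_left hK'
  set Y := max |K| ((D + |c|) / |a|) with hYdef
  have hY : ∀ t ∈ interior S.I, |c * S.ρ t + d * Real.sin (S.θ t)| ≤ Y := fun t ht => by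
    have hd := S.abs_sub_le_det hdet t
    have hx := (hpow t ht).1
    have hy := (hpow t ht).2
    set x := a * S.ρ t + b * Real.sin (S.θ t)
    set y := c * S.ρ t + d * Real.sin (S.θ t)
    rcases le_total 1 x with h1 | h1
    · refine le_trans ?_ (le_max_left _ _)
      rw [hy, abs_mul, abs_of_pos (Real.rpow_pos_of_pos hx _)]
      exact mul_le_of_le_one_right hK'.le (Real.rpow_le_one_of_one_le_of_nonpos h1 hlam.le)
    · refine le_trans ?_ (le_max_right _ _)
      rw [le_div_iff₀ ha', mul_comm, ← abs_mul]
      calc |a * y| = |(a * y - c * x) + c * x| := by rw [sub_add_cancel]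
        _ ≤ |a * y - c * x| + |c * x| := abs_add_le _ _
        _ ≤ D + |c| := by
          rw [abs_mul c, abs_of_pos hx]
          gcongr
          exact mul_le_of_le_one_right hc'.le h1
  have hX : ∀ t ∈ interior S.I, |a * S.ρ t + b * Real.sin (S.θ t)| ≤ (D + |a| * Y) / |c| :=
    fun t ht => by
    have hd := S.abs_sub_le_det hdet t
    have hy := hY t ht
    set x := a * S.ρ t + b * Real.sin (S.θ t)
    set y := c * S.ρ t + d * Real.sin (S.θ t)
    rw [le_div_iff₀ hc', mul_comm, ← abs_mul]
    calc |c * x| = |a * y - (a * y - c * x)| := by rw [sub_sub_cancel]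
      _ ≤ |a * y| + |a * y - c * x| := abs_sub _ _
      _ ≤ D + |a| * Y := by
        rw [abs_mul a, add_comm]
        gcongr
  obtain ⟨B, hB⟩ := S.exists_abs_ρ_le hdet.ne' hX hY
  have hm : 0 < (Y / |K|) ^ lam⁻¹ := by positivity
  have hx : ∀ t ∈ S.I, (Y / |K|) ^ lam⁻¹ ≤ a * S.ρ t + b * Real.sin (S.θ t) := fun t ht => by
    refine sub_nonneg.1 (S.ordConnected_I.nonneg_of_interior S.nonempty_interior_I
      ((S.continuousOn_lin a b).sub continuousOn_const) (fun t ht => sub_nonneg.2 ?_) t ht)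
    have hx := (hpow t ht).1
    have hy := hY t ht
    rw [(hpow t ht).2, abs_mul] at hy
    set x := a * S.ρ t + b * Real.sin (S.θ t)
    have hxl := Real.rpow_pos_of_pos hx lam
    rw [abs_of_pos hxl] at hy
    calc (Y / |K|) ^ lam⁻¹ ≤ (x ^ lam) ^ lam⁻¹ := by
          refine Real.rpow_le_rpow_of_nonpos hxl ?_ (inv_nonpos.2 hlam.le)
          rw [le_div_iff₀ hK']
          linarith
      _ = x := by rw [← Real.rpow_mul hx.le, mul_inv_cancel₀ hlam.ne, Real.rpow_one]
  exact S.exists_isPureLinear_of_rpow hdet hB rfl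
    (S.ordConnected_I.eqOn_of_interior S.nonempty_interior_I (S.continuousOn_lin c d)
      (continuousOn_const.mul ((S.continuousOn_lin a b).rpow_const fun t ht =>
        .inl (hm.trans_le (hx t ht)).ne')) fun t ht => (hpow t ht).2) (.inr hm) hx hn

/-- The trajectories of a saddle do not reach the origin. -/
theorem lin_ne_zero_of_neg {a b c d K lam : ℝ} (hlam : lam < 0) (hK : K ≠ 0)
    (hpow : ∀ t ∈ interior S.I, 0 < a * S.ρ t + b * Real.sin (S.θ t) ∧
      c * S.ρ t + d * Real.sin (S.θ t) = K * (a * S.ρ t + b * Real.sin (S.θ t)) ^ lam)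
    {t : ℝ} (ht : t ∈ S.I) : a * S.ρ t + b * Real.sin (S.θ t) ≠ 0 := fun h => by
  -- The first integral `y * x ^ (-lam) = K` extends continuously to end points and would be zero
  -- where `x = 0`.
  have h1 := S.ordConnected_I.eqOn_of_interior S.nonempty_interior_I
    (f := fun t => (c * S.ρ t + d * Real.sin (S.θ t))
      * (a * S.ρ t + b * Real.sin (S.θ t)) ^ (-lam)) (g := fun _ => K)
    ((S.continuousOn_lin c d).mul ((S.continuousOn_lin a b).rpow_const fun _ _ => by
      right; linarith)) continuousOn_const (fun t ht => by
      simp only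
      rw [(hpow t ht).2, mul_assoc, ← Real.rpow_add (hpow t ht).1]
      simp) ht
  simp only [h] at h1
  rw [Real.zero_rpow (by linarith), mul_zero] at h1
  exact hK h1.symm

/-! ### The elliptic, hyperbolic and parabolic cases -/

theorem IsSemiQuadratic.exists_isPureLinear_of_elliptic (hS : S.IsSemiQuadratic α β γ δ)
    (hΛ : 0 < Lambda₂ α β γ δ) (hell : α * δ < β * γ) (hcyl : ¬ S.IsCylinder) :
    ∃ lam < 0, ∃ S₀ : RevolutionSurface, S₀.IsPureLinear lam ∧ S.IsImageOf S₀ := by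
  by_cases hδ : δ = 0
  · subst hδ
    rw [mul_zero] at hell
    have hsum : β + γ ≠ 0 := by
      intro h
      unfold Lambda₂ at hΛ
      rw [h] at hΛ
      simp at hΛ
    have hγ : γ ≠ 0 := by rintro rfl; simp at hell
    have hlam : -β / γ < 0 := by
      rw [show -β / γ = -(β * γ) / (γ * γ) by field_simp]
      exact div_neg_of_neg_of_pos (by linarith) (mul_self_pos.2 hγ)
    refine ⟨-β / γ, hlam, ?_⟩
    -- For `δ = 0` the eigencoordinates are `sin θ` and the axis distance of the parallel surface at
    -- distance `α / (β + γ)`. That surface has no pole or cusp, as `x ≠ 0`.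
    have hab : IsLeftEigen α β γ 0 1 (α / (β + γ)) γ := ⟨by ring, by field_simp; ring⟩
    have hcd : IsLeftEigen α β γ 0 0 1 (-β) := ⟨by ring, by ring⟩
    rcases hS.exists_rpow (by simpa using hell.ne) hcyl hab hcd (by norm_num) hγ with
      h | ⟨τ, K, hτ, hK, hpow⟩
    · exact h _
    have hx : ∀ t ∈ S.I, S.ρ t + α / (β + γ) * Real.sin (S.θ t) ≠ 0 := fun t ht h => by
      refine lin_ne_zero_of_neg hlam hK hpow ht ?_
      linear_combination τ * h
    have key : ∀ t ∈ S.I, (α * Real.sin (S.θ t) + γ * S.ρ t) * (1 + α / (β + γ) * S.k₂ t)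
        = γ * (S.ρ t + α / (β + γ) * Real.sin (S.θ t)) := fun t ht => by
      simpa using hS.mul_lin hab ht
    refine exists_isPureLinear_of_parallel (v := α / (β + γ)) (fun t ht h => ?_) hx fun t ht => ?_
    · have := key t ht
      rw [h, mul_zero] at this
      exact mul_ne_zero hγ (hx t ht) this.symm
    · have h1 := key t ht
      have h2 := hS.k₂_mul ht
      have h3 : γ * (S.k₂ t * (S.ρ t + α / (β + γ) * Real.sin (S.θ t)))
          = γ * (-β / γ * Real.sin (S.θ t) * (1 + α / (β + γ) * S.k₂ t)) := by
        have h4 : γ * (-β / γ) = -β := by field_simp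
        linear_combination -S.k₂ t * h1 + (1 + α / (β + γ) * S.k₂ t) * h2
          - (Real.sin (S.θ t) * (1 + α / (β + γ) * S.k₂ t)) * h4
      exact mul_left_cancel₀ hγ h3
  · obtain ⟨μ₁, μ₂, h₁, h₂, hne, hprod⟩ := exists_eigenvalues hΛ
    obtain ⟨a, b, c, d, hab, hcd, hdet⟩ := exists_isLeftEigen_pair h₁ h₂ hne
    have hμ : μ₁ ≠ 0 := by rintro rfl; linarith
    have hlam : μ₂ / μ₁ < 0 := by
      rw [show μ₂ / μ₁ = μ₁ * μ₂ / (μ₁ * μ₁) by field_simp]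
      exact div_neg_of_neg_of_pos (by linarith) (mul_self_pos.2 hμ)
    -- The eigenline of `sin θ` occurs only for `δ = 0`, so neither coordinate is a multiple of `sin
    -- θ`.
    have ha : a ≠ 0 := by
      rintro rfl
      have hb : b * δ = 0 := by linear_combination -hab.left
      rw [(mul_eq_zero.1 hb).resolve_right hδ] at hdet
      simp at hdet
    have hc : c ≠ 0 := by
      rintro rfl
      have hd : d * δ = 0 := by linear_combination -hcd.left
      rw [(mul_eq_zero.1 hd).resolve_right hδ] at hdet
      simp at hdet
    refine ⟨μ₂ / μ₁, hlam, ?_⟩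
    rcases hS.exists_rpow hell.ne hcyl hab hcd hdet hμ with h | ⟨τ, K, hτ, hK, hpow⟩
    · exact h _
    have hτ0 : τ ≠ 0 := by rintro rfl; simp at hτ
    exact exists_isPureLinear_of_neg (by linear_combination hdet - (a * d - b * c) * hτ)
      (mul_ne_zero hτ0 ha) (mul_ne_zero hτ0 hc) hlam hK hpow
      (nontrivial_image_of_lin_pos hS hcyl (hab.smul τ) hμ fun t ht => (hpow t ht).1)

theorem IsSemiQuadratic.exists_isPureLinear_of_hyperbolic (hS : S.IsSemiQuadratic α β γ δ)
    (hΛ : 0 < Lambda₂ α β γ δ) (hhyp : β * γ < α * δ) (hcyl : ¬ S.IsCylinder) :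
    ∃ lam > 0, ∃ S₀ : RevolutionSurface, S₀.IsPureLinear lam ∧ S.IsImageOf S₀ := by
  -- The eigenvalues have equal signs; taking the one of larger modulus as numerator gives an
  -- exponent above 1.
  obtain ⟨μ₁, μ₂, h₁, h₂, hμ, hlam⟩ : ∃ μ₁ μ₂ : ℝ, (μ₁ - γ) * (μ₁ + β) + α * δ = 0 ∧
      (μ₂ - γ) * (μ₂ + β) + α * δ = 0 ∧ μ₁ ≠ 0 ∧ 1 < μ₂ / μ₁ := by
    obtain ⟨μ₁, μ₂, h₁, h₂, hne, hprod⟩ := exists_eigenvalues hΛ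
    have hpos : 0 < μ₁ * μ₂ := by linarith
    rcases pos_and_pos_or_neg_and_neg_of_mul_pos hpos with ⟨h3, h4⟩ | ⟨h3, h4⟩ <;>
      rcases lt_or_gt_of_ne hne with h | h
    · exact ⟨μ₁, μ₂, h₁, h₂, h3.ne', (one_lt_div h3).2 h⟩
    · exact ⟨μ₂, μ₁, h₂, h₁, h4.ne', (one_lt_div h4).2 h⟩
    · exact ⟨μ₂, μ₁, h₂, h₁, h4.ne, (one_lt_div_of_neg h4).2 h⟩
    · exact ⟨μ₁, μ₂, h₁, h₂, h3.ne, (one_lt_div_of_neg h3).2 h⟩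
  obtain ⟨a, b, c, d, hab, hcd, hdet⟩ := exists_isLeftEigen_pair h₁ h₂ (by
    rintro rfl
    simp [hμ] at hlam)
  refine ⟨μ₂ / μ₁, by linarith, ?_⟩
  rcases hS.exists_rpow hhyp.ne' hcyl hab hcd hdet hμ with h | ⟨τ, K, hτ, hK, hpow⟩
  · exact h _
  exact exists_isPureLinear_of_one_lt (by linear_combination hdet - (a * d - b * c) * hτ) hlam hK
    hpow (nontrivial_image_of_lin_pos hS hcyl (hab.smul τ) hμ fun t ht => (hpow t ht).1)

theorem IsSemiQuadratic.exists_isPureLinear_of_parabolic (hS : S.IsSemiQuadratic α β γ δ)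
    (hΛ : 0 < Lambda₂ α β γ δ) (hpar : α * δ = β * γ) (hcyl : ¬ S.IsCylinder) :
    ∃ S₀ : RevolutionSurface, S₀.IsPureLinear 0 ∧ S.IsImageOf S₀ := by
  obtain ⟨k, hk⟩ := hS.exists_k₂_eq hpar (by
    rintro ⟨rfl, rfl, rfl, rfl⟩
    simp [Lambda₂] at hΛ)
  obtain ⟨t₀, ht₀⟩ := S.nonempty_interior_I.mono interior_subset
  refine exists_isPureLinear_of_affine (k := k) (e := -k * S.ρ t₀ + 1 * Real.sin (S.θ t₀)) hcyl
    (fun t ht => ?_) (.inr rfl)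
  have := S.ordConnected_I.eq_of_hasDerivWithinAt_zero
    (fun t ht => (S.hasDerivWithinAt_lin (-k) 1 ht).congr_deriv (by rw [hk t ht]; ring)) ht ht₀
  linear_combination this

end RevolutionSurface

theorem theorem4p22 (S : RevolutionSurface) (α β γ δ : ℝ)
    (hS : S.IsSemiQuadratic α β γ δ) (hΛ : 0 < Lambda₂ α β γ δ) :
    ∃ (lam : ℝ) (S₀ : RevolutionSurface), S₀.IsPureLinear lam ∧ S.IsImageOf S₀ ∧
      (Lambda₁ β γ ^ 2 < Lambda₂ α β γ δ → ¬ S.IsCylinder → lam < 0) ∧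
      (Lambda₂ α β γ δ < Lambda₁ β γ ^ 2 → ¬ S.IsCylinder → 0 < lam) := by
  have hdiff : Lambda₁ β γ ^ 2 - Lambda₂ α β γ δ = 4 * (α * δ - β * γ) := by
    unfold Lambda₁ Lambda₂
    ring
  by_cases hcyl : S.IsCylinder
  · exact ⟨0, S, S.isPureLinear_of_k₂_eq_zero fun t ht => hcyl.k₂_eq_zero ht, S.isImageOf_self,
      fun _ h => absurd hcyl h, fun _ h => absurd hcyl h⟩
  rcases lt_trichotomy (α * δ) (β * γ) with h | h | h
  · obtain ⟨lam, hlam, S₀, h₁, h₂⟩ := hS.exists_isPureLinear_of_elliptic hΛ h hcyl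
    exact ⟨lam, S₀, h₁, h₂, fun _ _ => hlam, fun h' => by linarith⟩
  · obtain ⟨S₀, h₁, h₂⟩ := hS.exists_isPureLinear_of_parabolic hΛ h hcyl
    exact ⟨0, S₀, h₁, h₂, fun h' => by linarith, fun h' => by linarith⟩
  · obtain ⟨lam, hlam, S₀, h₁, h₂⟩ := hS.exists_isPureLinear_of_hyperbolic hΛ h hcyl
    exact ⟨lam, S₀, h₁, h₂, fun h' => by linarith, fun _ _ => hlam⟩
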